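/- Let $V$ be a complex vector space of finite dimension $n$. A reflection of $V$ is an element $t\in GL(V)$ whose fixed space has dimension $n-1$; a complex reflection group on $V$ is a finite subgroup $W\subseteq GL(V)$ generated by reflections; it is irreducible if it cannot be written as a product $W_1\times W_2$ of reflection groups acting on $V=V_1\oplus V_2$ with $V_1\neq 0\neq V_2$. Let $W$ be an irreducible complex reflection group on $V$, and, if $n=1$, assume that $W$ is not the trivial group. Let $W$ act on the dual space $V^*$ contragrediently and on the exterior algebra $\wedge(V\oplus V^*)$ by the induced action, and place $V$ in bidegree $(1,0)$ and $V^*$ in bidegree $(0,1)$. Let $$DR_W=\wedge(V\oplus V^*)/\langle\wedge(V\oplus V^*)^W_+\rangle$$ be the quotient by the two-sided ideal generated by the $W$-invariant elements with vanishing constant term, with the induced bigrading $(DR_W)_{i,j}$. Then for all $0\le k\le n$, $$\dim_{\mathbb C}(DR_W)_{k,n-k}=\mathrm{Nar}(n+1,k+1),\qquad\text{where } \mathrm{Nar}(m,j)=\frac1m\binom mj\binom m{j-1},$$ and hence $$\sum_{k=0}^n\dim_{\mathbb C}(DR_W)_{k,n-k}=\mathrm{Cat}(n+1),\qquad\text{where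 } \mathrm{Cat}(m)=\frac1{m+1}\binom{2m}m .$$ -/

import Mathlib

noncomputable section

namespace FermionicCoinvariants

/-- A linear automorphism `t` of `V` is a reflection if its fixed space has dimension
`dim V - 1`. -/
def IsReflection {V : Type*} [AddCommGroup V] [Module ℂ V] (t : V ≃ₗ[ℂ] V) : Prop :=
  Module.finrank ℂ (LinearMap.eqLocus (t : V →ₗ[ℂ] V) LinearMap.id) + 1 = Module.finrank ℂ V

/-- A complex reflection group: a finite subgroup of `GL(V)` generated by reflections. -/
structure IsComplexReflectionGroup {V : Type*} [AddCommGroup V] [Module ℂ V]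
    (W : Subgroup (V ≃ₗ[ℂ] V)) : Prop where
  finite : Finite W
  generated : Subgroup.closure {t : V ≃ₗ[ℂ] V | t ∈ W ∧ IsReflection t} = W

/-- `W` is the direct product `W₁ × W₂` acting on `V = V₁ ⊕ V₂`: the elements of `W` are exactly
the maps `g₁ ⊕ g₂` with `g₁ ∈ W₁` and `g₂ ∈ W₂`. -/
def IsProductOf {V : Type*} [AddCommGroup V] [Module ℂ V] (W : Subgroup (V ≃ₗ[ℂ] V))
    {V₁ V₂ : Submodule ℂ V} (W₁ : Subgroup (V₁ ≃ₗ[ℂ] V₁)) (W₂ : Subgroup (V₂ ≃ₗ[ℂ] V₂)) : Prop :=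
  ∀ g : V ≃ₗ[ℂ] V, g ∈ W ↔
    ∃ g₁ ∈ W₁, ∃ g₂ ∈ W₂, (∀ x : V₁, g x = g₁ x) ∧ (∀ x : V₂, g x = g₂ x)

/-- A reflection group `W` acting on `V` is irreducible if it cannot be written as a product
`W₁ × W₂` of reflection groups acting on `V = V₁ ⊕ V₂`, unless `V₁ = 0` or `V₂ = 0`. -/
def IsIrreducible {V : Type*} [AddCommGroup V] [Module ℂ V]
    (W : Subgroup (V ≃ₗ[ℂ] V)) : Prop :=
  ∀ (V₁ V₂ : Submodule ℂ V), IsCompl V₁ V₂ →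
    ∀ (W₁ : Subgroup (V₁ ≃ₗ[ℂ] V₁)) (W₂ : Subgroup (V₂ ≃ₗ[ℂ] V₂)),
      IsComplexReflectionGroup W₁ → IsComplexReflectionGroup W₂ →
        IsProductOf W W₁ W₂ → V₁ = ⊥ ∨ V₂ = ⊥

/-- The exterior algebra `⋀(V ⊕ V*)`. -/
abbrev Ext (V : Type*) [AddCommGroup V] [Module ℂ V] : Type _ :=
  ExteriorAlgebra ℂ (V × Module.Dual ℂ V)

/-- The action of `g ∈ GL(V)` on `⋀(V ⊕ V*)`, induced by `(v, φ) ↦ (g v, φ ∘ g⁻¹)`. -/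
def act {V : Type*} [AddCommGroup V] [Module ℂ V] (g : V ≃ₗ[ℂ] V) : Ext V →ₐ[ℂ] Ext V :=
  ExteriorAlgebra.map
    (LinearMap.prodMap (g : V →ₗ[ℂ] V) (g.symm.dualMap : Module.Dual ℂ V →ₗ[ℂ] Module.Dual ℂ V))

/-- The `W`-invariants of `⋀(V ⊕ V*)` with vanishing constant term. -/
def positiveInvariants {V : Type*} [AddCommGroup V] [Module ℂ V]
    (W : Subgroup (V ≃ₗ[ℂ] V)) : Set (Ext V) :=
  {x | (∀ g ∈ W, act g x = x) ∧ ExteriorAlgebra.algebraMapInv x = 0}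

/-- The two-sided ideal generated by the invariants with vanishing constant term. -/
def coinvariantIdeal {V : Type*} [AddCommGroup V] [Module ℂ V]
    (W : Subgroup (V ≃ₗ[ℂ] V)) : TwoSidedIdeal (Ext V) :=
  TwoSidedIdeal.span (positiveInvariants W)

/-- The fermionic diagonal coinvariant ring `DR_W`. -/
abbrev DR {V : Type*} [AddCommGroup V] [Module ℂ V] (W : Subgroup (V ≃ₗ[ℂ] V)) : Type _ :=
  (coinvariantIdeal W).ringCon.Quotient

/-- The component of bidegree `(i, j)` of `⋀(V ⊕ V*)`, where `V` has bidegree `(1, 0)` and `V*`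
has bidegree `(0, 1)`: the span of the products of `i` elements of `V` and `j` elements
of `V*`. -/
def extPiece (V : Type*) [AddCommGroup V] [Module ℂ V] (i j : ℕ) : Submodule ℂ (Ext V) :=
  (LinearMap.range
      (ExteriorAlgebra.ι ℂ ∘ₗ LinearMap.inl ℂ V (Module.Dual ℂ V))) ^ i *
    (LinearMap.range
      (ExteriorAlgebra.ι ℂ ∘ₗ LinearMap.inr ℂ V (Module.Dual ℂ V))) ^ j

/-- The component `(DR_W)_{i,j}` of bidegree `(i, j)`: the image of the corresponding component
of `⋀(V ⊕ V*)` (the defining ideal is bihomogeneous). -/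
def drPiece {V : Type*} [AddCommGroup V] [Module ℂ V] (W : Subgroup (V ≃ₗ[ℂ] V)) (i j : ℕ) :
    Submodule ℂ (DR W) :=
  (extPiece V i j).map ((coinvariantIdeal W).ringCon.mkₐ (α := ℂ)).toLinearMap

/-- The Narayana numbers `Nar(n, k) = (1 / n) * C(n, k) * C(n, k - 1)`, with `C(n, -1) = 0`. -/
def narayana : ℕ → ℕ → ℚ
  | _, 0 => 0
  | n, k + 1 => 1 / (n : ℚ) * (n.choose (k + 1) : ℚ) * (n.choose k : ℚ)

end FermionicCoinvariants

end

noncomputable section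

namespace FermionicCoinvariants

open Module

/-! ### Multiplication and contraction operators -/

variable {V : Type*} [AddCommGroup V] [Module ℂ V]

/-! The coinvariant ideal is principal, generated by the canonical element ℓ of V ⊗ V*
(`lefschetz`), and ℓ acts as a Lefschetz operator.

Invariance under W already forces invariance under gl(V). An element x fixed by the reflection v ↦ v
+ f(v)a is killed by the derivation a ⊗ f (`rankOneDer_eq_zero_of_act`). Commutators of such
derivations yield the mixed ones (`rankOneDer_mixed`), and irreducibility spreads them to all of
gl(V) (`rankOneDer_eq_zero`). The definition of irreducibility concerns product decompositions;
Maschke's theorem turns it into the absence of proper stable subspaces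
(`eq_bot_or_eq_top_of_stable`).

A gl(V)-invariant lives in bidegrees (i, i), and a Casimir identity (`lefschetz_mul_dualLefschetz`)
writes i(i - n - 1)x as a multiple of ℓ. Hence the ideal consists of the multiples of ℓ
(`mem_coinvariantIdeal_iff`).

The sl₂-relation between ℓ and its adjoint makes multiplication by ℓ injective below total degree n
(`eq_zero_of_lefschetz_mul_eq_zero`). So for 0 < k < n the quotient in bidegree (k, n-k) has
dimension C(n,k)C(n,n-k) - C(n,k-1)C(n,n-k-1), a Narayana number; for k = 0 and k = n nothing is
subtracted. Vandermonde's identity sums these numbers to a Catalan number. -/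

/-- The inclusion of `V` into `⋀(V ⊕ V*)`. -/
def vec : V →ₗ[ℂ] Ext V := ExteriorAlgebra.ι ℂ ∘ₗ LinearMap.inl ℂ V (Dual ℂ V)

/-- The inclusion of `V*` into `⋀(V ⊕ V*)`. -/
def covec : Dual ℂ V →ₗ[ℂ] Ext V := ExteriorAlgebra.ι ℂ ∘ₗ LinearMap.inr ℂ V (Dual ℂ V)

/-- Contraction of the `V`-part with a linear form on `V`. -/
def dVec : Dual ℂ V →ₗ[ℂ] End ℂ (Ext V) :=
  CliffordAlgebra.contractLeft ∘ₗ (LinearMap.fst ℂ V (Dual ℂ V)).dualMap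

/-- Contraction of the `V*`-part with a vector of `V`. -/
def dCovec : V →ₗ[ℂ] End ℂ (Ext V) :=
  CliffordAlgebra.contractLeft ∘ₗ (LinearMap.snd ℂ V (Dual ℂ V)).dualMap ∘ₗ Dual.eval ℂ V

lemma ι_eq (m : V × Dual ℂ V) : ExteriorAlgebra.ι ℂ m = vec m.1 + covec m.2 := by
  simp [vec, covec, ← map_add]

lemma dVec_ι_mul (φ : Dual ℂ V) (m : V × Dual ℂ V) (x : Ext V) :
    dVec φ (ExteriorAlgebra.ι ℂ m * x) = φ m.1 • x - ExteriorAlgebra.ι ℂ m * dVec φ x :=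
  CliffordAlgebra.contractLeft_ι_mul _ _ _

lemma dCovec_ι_mul (v : V) (m : V × Dual ℂ V) (x : Ext V) :
    dCovec v (ExteriorAlgebra.ι ℂ m * x) = m.2 v • x - ExteriorAlgebra.ι ℂ m * dCovec v x :=
  CliffordAlgebra.contractLeft_ι_mul _ _ _

lemma dVec_one (φ : Dual ℂ V) : dVec φ (1 : Ext V) = 0 :=
  CliffordAlgebra.contractLeft_one _ _

lemma dCovec_one (v : V) : dCovec v (1 : Ext V) = 0 :=
  CliffordAlgebra.contractLeft_one _ _

lemma dVec_vec_mul (φ : Dual ℂ V) (v : V) (x : Ext V) :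
    dVec φ (vec v * x) = φ v • x - vec v * dVec φ x :=
  dVec_ι_mul φ (v, 0) x

lemma dVec_covec_mul (φ ψ : Dual ℂ V) (x : Ext V) :
    dVec φ (covec ψ * x) = -(covec ψ * dVec φ x) := by
  refine (dVec_ι_mul φ (0, ψ) x).trans ?_
  rw [map_zero, zero_smul, zero_sub]; rfl

lemma dCovec_vec_mul (v w : V) (x : Ext V) :
    dCovec v (vec w * x) = -(vec w * dCovec v x) := by
  refine (dCovec_ι_mul v (w, 0) x).trans ?_
  rw [LinearMap.zero_apply, zero_smul, zero_sub]; rfl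

lemma dCovec_covec_mul (v : V) (φ : Dual ℂ V) (x : Ext V) :
    dCovec v (covec φ * x) = φ v • x - covec φ * dCovec v x :=
  dCovec_ι_mul v (0, φ) x

lemma dVec_dVec (φ ψ : Dual ℂ V) (x : Ext V) : dVec φ (dVec ψ x) = -dVec ψ (dVec φ x) :=
  CliffordAlgebra.contractLeft_comm _ _ _

lemma dVec_dCovec (φ : Dual ℂ V) (v : V) (x : Ext V) :
    dVec φ (dCovec v x) = -dCovec v (dVec φ x) :=
  CliffordAlgebra.contractLeft_comm _ _ _

lemma dCovec_dCovec (v w : V) (x : Ext V) : dCovec v (dCovec w x) = -dCovec w (dCovec v x) :=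
  CliffordAlgebra.contractLeft_comm _ _ _

lemma ι_mul_ι_mul (m m' : V × Dual ℂ V) (x : Ext V) :
    ExteriorAlgebra.ι ℂ m * (ExteriorAlgebra.ι ℂ m' * x) =
      -(ExteriorAlgebra.ι ℂ m' * (ExteriorAlgebra.ι ℂ m * x)) := by
  rw [← mul_assoc, ← mul_assoc, ← neg_mul]
  congr 1
  exact eq_neg_of_add_eq_zero_left (ExteriorAlgebra.ι_add_mul_swap m m')

lemma vec_mul_covec_mul (v : V) (φ : Dual ℂ V) (x : Ext V) :
    vec v * (covec φ * x) = -(covec φ * (vec v * x)) :=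
  ι_mul_ι_mul _ _ _

lemma ι_mul_self_mul (m : V × Dual ℂ V) (x : Ext V) :
    ExteriorAlgebra.ι ℂ m * (ExteriorAlgebra.ι ℂ m * x) = 0 := by
  rw [← mul_assoc, ExteriorAlgebra.ι_sq_zero, zero_mul]

lemma vec_mul_self_mul (v : V) (x : Ext V) : vec v * (vec v * x) = 0 :=
  ι_mul_self_mul _ _

lemma covec_mul_self_mul (φ : Dual ℂ V) (x : Ext V) : covec φ * (covec φ * x) = 0 :=
  ι_mul_self_mul _ _

-- Left multiplication by generators is the induction step because contractions and derivations are
-- both given by their rule on such products.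
@[elab_as_elim]
lemma ext_induction {P : Ext V → Prop} (x : Ext V) (one : P 1)
    (smul : ∀ (c : ℂ) x, P x → P (c • x)) (add : ∀ x y, P x → P y → P (x + y))
    (ι_mul : ∀ m x, P x → P (ExteriorAlgebra.ι ℂ m * x)) : P x := by
  refine CliffordAlgebra.left_induction _ (fun r => ?_) add (fun x m hx => ι_mul m x hx) x
  rw [Algebra.algebraMap_eq_smul_one]
  exact smul _ _ one

/-! ### Derivations of the exterior algebra -/

/-- `T` is the derivation of the exterior algebra extending the endomorphism `L`. -/
structure IsDer (T : End ℂ (Ext V)) (L : End ℂ (V × Dual ℂ V)) : Prop where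
  map_one : T 1 = 0
  map_ι_mul : ∀ m x, T (ExteriorAlgebra.ι ℂ m * x) =
    ExteriorAlgebra.ι ℂ (L m) * x + ExteriorAlgebra.ι ℂ m * T x

namespace IsDer

variable {T T' : End ℂ (Ext V)} {L L' : End ℂ (V × Dual ℂ V)}

/-- Reduces identities between derivations to identities between endomorphisms of V ⊕ V*. -/
lemma unique (h : IsDer T L) (h' : IsDer T' L) : T = T' := by
  refine LinearMap.ext fun x => ?_
  induction x using ext_induction with
  | one => rw [h.map_one, h'.map_one]
  | smul c x hx => rw [map_smul, map_smul, hx]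
  | add x y hx hy => rw [map_add, map_add, hx, hy]
  | ι_mul m x hx => rw [h.map_ι_mul, h'.map_ι_mul, hx]

lemma smul (c : ℂ) (h : IsDer T L) : IsDer (c • T) (c • L) where
  map_one := by simp [h.map_one]
  map_ι_mul m x := by simp [h.map_ι_mul]

lemma add (h : IsDer T L) (h' : IsDer T' L') : IsDer (T + T') (L + L') where
  map_one := by simp [h.map_one, h'.map_one]
  map_ι_mul m x := by
    simp only [LinearMap.add_apply, h.map_ι_mul, h'.map_ι_mul, map_add, add_mul, mul_add]; abel

lemma sub (h : IsDer T L) (h' : IsDer T' L') : IsDer (T - T') (L - L') where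
  map_one := by simp [h.map_one, h'.map_one]
  map_ι_mul m x := by
    simp only [LinearMap.sub_apply, h.map_ι_mul, h'.map_ι_mul, map_sub, sub_mul, mul_sub]; abel

lemma sum {ι : Type*} (s : Finset ι) {T : ι → End ℂ (Ext V)} {L : ι → End ℂ (V × Dual ℂ V)}
    (h : ∀ i ∈ s, IsDer (T i) (L i)) : IsDer (∑ i ∈ s, T i) (∑ i ∈ s, L i) where
  map_one := by
    rw [LinearMap.sum_apply]
    exact Finset.sum_eq_zero fun i hi => (h i hi).map_one
  map_ι_mul m x := by
    simp only [LinearMap.sum_apply, map_sum, Finset.sum_mul, Finset.mul_sum,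
      ← Finset.sum_add_distrib]
    exact Finset.sum_congr rfl fun i hi => (h i hi).map_ι_mul m x

lemma commutator (h : IsDer T L) (h' : IsDer T' L') :
    IsDer (T * T' - T' * T) (L * L' - L' * L) where
  map_one := by simp [h.map_one, h'.map_one]
  map_ι_mul m x := by
    simp only [LinearMap.sub_apply, Module.End.mul_apply, h.map_ι_mul, h'.map_ι_mul, map_add,
      map_sub, sub_mul, mul_sub]
    abel

end IsDer

/-! ### The action of gl(V) by derivations -/

/-- The rank one endomorphism `(v, φ) ↦ (f(v) a, -φ(a) f)` of `V ⊕ V*`. -/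
def rankOne (a : V) (f : Dual ℂ V) : End ℂ (V × Dual ℂ V) :=
  LinearMap.prodMap (f.smulRight a) (-((Dual.eval ℂ V a).smulRight f))

/-- The derivation of `⋀(V ⊕ V*)` given by the element `a ⊗ f` of `gl(V)`. -/
def rankOneDer (a : V) (f : Dual ℂ V) : End ℂ (Ext V) :=
  LinearMap.mulLeft ℂ (vec a) * dVec f - LinearMap.mulLeft ℂ (covec f) * dCovec a

lemma rankOneDer_apply (a : V) (f : Dual ℂ V) (x : Ext V) :
    rankOneDer a f x = vec a * dVec f x - covec f * dCovec a x := rfl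

lemma isDer_vec_dVec (a : V) (f : Dual ℂ V) :
    IsDer (LinearMap.mulLeft ℂ (vec a) * dVec f) (LinearMap.prodMap (f.smulRight a) 0) where
  map_one := by simp [dVec_one]
  map_ι_mul m x := by
    have h : vec a * (ExteriorAlgebra.ι ℂ m * dVec f x) =
        -(ExteriorAlgebra.ι ℂ m * (vec a * dVec f x)) := ι_mul_ι_mul _ _ _
    simp only [Module.End.mul_apply, LinearMap.mulLeft_apply, dVec_ι_mul, mul_sub, h]
    simp [ι_eq]

lemma isDer_covec_dCovec (a : V) (f : Dual ℂ V) :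
    IsDer (LinearMap.mulLeft ℂ (covec f) * dCovec a)
      (LinearMap.prodMap 0 ((Dual.eval ℂ V a).smulRight f)) where
  map_one := by simp [dCovec_one]
  map_ι_mul m x := by
    have h : covec f * (ExteriorAlgebra.ι ℂ m * dCovec a x) =
        -(ExteriorAlgebra.ι ℂ m * (covec f * dCovec a x)) := ι_mul_ι_mul _ _ _
    simp only [Module.End.mul_apply, LinearMap.mulLeft_apply, dCovec_ι_mul, mul_sub, h]
    simp [ι_eq]

lemma isDer_rankOneDer (a : V) (f : Dual ℂ V) : IsDer (rankOneDer a f) (rankOne a f) := by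
  have h : rankOne a f =
      LinearMap.prodMap (f.smulRight a) 0 - LinearMap.prodMap 0 ((Dual.eval ℂ V a).smulRight f) := by
    refine LinearMap.ext fun m => ?_
    ext <;> simp [rankOne]
  rw [h]
  exact (isDer_vec_dVec a f).sub (isDer_covec_dCovec a f)

/-- By uniqueness of derivations this is the bracket of rank one matrices, checked on V ⊕ V*. -/
lemma rankOneDer_commutator (a b : V) (f g : Dual ℂ V) (x : Ext V) :
    rankOneDer a f (rankOneDer b g x) - rankOneDer b g (rankOneDer a f x) =
      f b • rankOneDer a g x - g a • rankOneDer b f x := by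
  have h := (isDer_rankOneDer a f).commutator (isDer_rankOneDer b g)
  have h' := ((isDer_rankOneDer a g).smul (f b)).sub ((isDer_rankOneDer b f).smul (g a))
  have e : rankOne a f * rankOne b g - rankOne b g * rankOne a f =
      f b • rankOne a g - g a • rankOne b f := by
    refine LinearMap.ext fun m => ?_
    ext <;> simp [rankOne, smul_smul, mul_comm]
    ring
  rw [e] at h
  simpa using LinearMap.congr_fun (h.unique h') x

lemma rankOneDer_add_right (a : V) (f g : Dual ℂ V) :
    rankOneDer a (f + g) = rankOneDer a f + rankOneDer a g := by
  refine LinearMap.ext fun x => ?_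
  simp [rankOneDer_apply, add_mul, mul_add]; abel

lemma rankOneDer_smul_right (c : ℂ) (a : V) (f : Dual ℂ V) :
    rankOneDer a (c • f) = c • rankOneDer a f := by
  refine LinearMap.ext fun x => ?_
  simp [rankOneDer_apply, smul_sub]

lemma rankOneDer_add_left (a b : V) (f : Dual ℂ V) :
    rankOneDer (a + b) f = rankOneDer a f + rankOneDer b f := by
  refine LinearMap.ext fun x => ?_
  simp [rankOneDer_apply, add_mul, mul_add]; abel

lemma rankOneDer_smul_left (c : ℂ) (a : V) (f : Dual ℂ V) :
    rankOneDer (c • a) f = c • rankOneDer a f := by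
  refine LinearMap.ext fun x => ?_
  simp [rankOneDer_apply, smul_sub]

/-- If `a ⊗ g` and `b ⊗ h` kill `x` and `h(b) ≠ 0`, then so do `g(b) a ⊗ h` and `h(a) b ⊗ g`. -/
lemma rankOneDer_mixed {a b : V} {g h : Dual ℂ V} {x : Ext V} (hb : h b ≠ 0)
    (h₁ : rankOneDer a g x = 0) (h₂ : rankOneDer b h x = 0) :
    rankOneDer (h a • b) g x = 0 ∧ rankOneDer a (g b • h) x = 0 := by
  -- The two mixed terms are eigenvectors of b ⊗ h with opposite eigenvalues ±h(b). Their difference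
  -- vanishes by `e₁`; applying b ⊗ h to it shows that their sum vanishes too.
  have e₁ := rankOneDer_commutator b a h g x
  have e₂ := rankOneDer_commutator b b h g x
  have e₃ := rankOneDer_commutator b a h h x
  simp only [h₁, h₂, map_zero, sub_zero, smul_zero, zero_sub] at e₁ e₂ e₃
  have e₄ := congrArg (rankOneDer b h) e₁
  simp only [map_zero, map_sub, map_smul, e₂, e₃] at e₄
  rw [rankOneDer_smul_left, rankOneDer_smul_right, LinearMap.smul_apply, LinearMap.smul_apply]
  have e₅ : h a • rankOneDer b g x + g b • rankOneDer a h x = 0 := by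
    have : h b • (h a • rankOneDer b g x + g b • rankOneDer a h x) = 0 := by
      rw [e₄]; module
    exact (smul_eq_zero.mp this).resolve_left hb
  have e₆ : h a • rankOneDer b g x = g b • rankOneDer a h x := (sub_eq_zero.mp e₁.symm)
  rw [e₆, ← two_smul ℂ, smul_eq_zero] at e₅
  have := e₅.resolve_left two_ne_zero
  exact ⟨e₆.trans this, this⟩

/-! ### Reflections and the rank one derivations they define -/

/-- An element fixed by the reflection `v ↦ v + f(v) a` is killed by the derivation `a ⊗ f`. -/
lemma rankOneDer_eq_zero_of_act {t : V ≃ₗ[ℂ] V} {a : V} {f : Dual ℂ V}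
    (ht : ∀ v, t v = v + f v • a) (hfa : f a ≠ 0) {x : Ext V} (hx : act t x = x) :
    rankOneDer a f x = 0 := by
  have ha0 : a ≠ 0 := by rintro rfl; simp at hfa
  have hs : 1 + f a ≠ 0 := fun h => by
    have : t a = 0 := by
      rw [ht, eq_neg_of_add_eq_zero_right h]; module
    exact ha0 (by simpa using this)
  -- 1 + f(a) is the eigenvalue of t on a; its inverse is the coefficient occurring in t⁻¹, hence in
  -- the contragredient action.
  set c := (1 + f a)⁻¹ with hc
  have hsymm : ∀ v, t.symm v = v - (c * f v) • a := fun v => by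
    rw [LinearEquiv.symm_apply_eq, ht, map_sub, map_smul]
    have : f v = c * f v + c * f v * f a := by rw [hc]; field_simp
    simp only [smul_eq_mul]
    nth_rewrite 2 [this]
    module
  have hdual : ∀ φ : Dual ℂ V, t.symm.dualMap φ = φ - (c * φ a) • f := fun φ => by
    ext v
    simp [hsymm]
    ring
  let P : End ℂ (Ext V) := LinearMap.mulLeft ℂ (vec a) * dVec f
  let Q : End ℂ (Ext V) := LinearMap.mulLeft ℂ (covec f) * dCovec a
  have hP := isDer_vec_dVec a f
  have hQ := isDer_covec_dCovec a f
  -- That is, t acts as (1 + P)(1 - cQ): the first factor acts through V, the second through V*.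
  have hact : ∀ y, act t y = y + P y - c • Q y - c • P (Q y) := fun y => by
    induction y using ext_induction with
    | one => simp [P, Q, dVec_one, dCovec_one]
    | smul d y hy => rw [map_smul, hy]; simp only [map_smul]; module
    | add y z hy hz => rw [map_add, hy, hz]; simp only [map_add]; module
    | ι_mul m y hy =>
      rw [map_mul, hy]
      have e : act t (ExteriorAlgebra.ι ℂ m) =
          ExteriorAlgebra.ι ℂ m + f m.1 • vec a - (c * m.2 a) • covec f := by
        simp only [act, ExteriorAlgebra.map_apply_ι]
        rw [ι_eq, ι_eq]
        simp [hdual, ht]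
        module
      have z₁ : vec a * P y = 0 := vec_mul_self_mul _ _
      have z₂ : covec f * Q y = 0 := covec_mul_self_mul _ _
      have z₃ : vec a * P (Q y) = 0 := vec_mul_self_mul _ _
      have z₄ : covec f * P (Q y) = 0 := by
        change covec f * (vec a * dVec f (covec f * dCovec a y)) = 0
        rw [dVec_covec_mul, ← neg_eq_zero, ← vec_mul_covec_mul, mul_neg, covec_mul_self_mul]
        simp
      have pm : P (ExteriorAlgebra.ι ℂ m * y) = f m.1 • (vec a * y) +
          ExteriorAlgebra.ι ℂ m * P y := by
        rw [hP.map_ι_mul]; simp [ι_eq, P]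
      have qm : ∀ y, Q (ExteriorAlgebra.ι ℂ m * y) = m.2 a • (covec f * y) +
          ExteriorAlgebra.ι ℂ m * Q y := fun y => by
        rw [hQ.map_ι_mul]; simp [ι_eq, Q]
      have pm' : P (ExteriorAlgebra.ι ℂ m * Q y) = f m.1 • (vec a * Q y) +
          ExteriorAlgebra.ι ℂ m * P (Q y) := by
        rw [hP.map_ι_mul]; simp [ι_eq, P]
      have pc : P (covec f * y) = covec f * P y := by
        have := hP.map_ι_mul (0, f) y
        simpa [ι_eq, P] using this
      rw [e, qm, map_add, map_smul, pm, pm', pc]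
      simp only [add_mul, sub_mul, mul_add, mul_sub, smul_mul_assoc, mul_smul_comm, z₁, z₂, z₃, z₄]
      module
  have hPP : ∀ y, P (P y) = f a • P y := fun y => by
    change vec a * dVec f (vec a * dVec f y) = f a • (vec a * dVec f y)
    rw [dVec_vec_mul, mul_sub, vec_mul_self_mul, sub_zero, mul_smul_comm]
  have hQQ : ∀ y, Q (Q y) = f a • Q y := fun y => by
    change covec f * dCovec a (covec f * dCovec a y) = f a • (covec f * dCovec a y)
    rw [dCovec_covec_mul, mul_sub, covec_mul_self_mul, sub_zero, mul_smul_comm]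
  have hPQ : ∀ y, P (Q y) = Q (P y) := fun y => by
    have := LinearMap.congr_fun ((hP.commutator hQ).unique
      (T' := 0) (by constructor <;> simp)) y
    simpa [sub_eq_zero, P, Q] using this
  -- P and Q commute and satisfy P² = f(a)P, Q² = f(a)Q. Applying each of them to this relation
  -- gives f(a)Px = PQx = f(a)Qx.
  have e₀ : P x - c • Q x - c • P (Q x) = 0 := by
    have := hact x
    rw [hx] at this
    linear_combination (norm := module) (1 : ℂ) • this.symm
  have hc0 : c ≠ 0 := inv_ne_zero hs
  have hcs : c * (1 + f a) = 1 := inv_mul_cancel₀ hs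
  have e₁ : P (Q x) = f a • P x := by
    have := congrArg P e₀
    simp only [map_sub, map_smul, hPP, map_zero] at this
    linear_combination (norm := module) (-1 : ℂ) • this - hcs • P (Q x)
  have e₂ : P (Q x) = f a • Q x := by
    have := congrArg Q e₀
    simp only [map_sub, map_smul, hQQ, map_zero, ← hPQ] at this
    have h : c • (P (Q x) - f a • Q x) = 0 := by
      linear_combination (norm := module) (1 : ℂ) • this + hcs • P (Q x)
    exact sub_eq_zero.mp ((smul_eq_zero.mp h).resolve_left hc0)
  have e₃ : f a • (P x - Q x) = 0 := by rw [smul_sub, ← e₁, ← e₂, sub_self]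
  exact (smul_eq_zero.mp e₃).resolve_left hfa

/-- The fixed space is the kernel of t - 1, so it is a hyperplane exactly when t - 1 has rank one.
-/
lemma isReflection_iff [FiniteDimensional ℂ V] (t : V ≃ₗ[ℂ] V) :
    IsReflection t ↔ ∃ (a : V) (f : Dual ℂ V), a ≠ 0 ∧ f ≠ 0 ∧ ∀ v, t v = v + f v • a := by
  have hker : LinearMap.eqLocus (t : V →ₗ[ℂ] V) LinearMap.id =
      LinearMap.ker ((t : V →ₗ[ℂ] V) - LinearMap.id) := LinearMap.eqLocus_eq_ker_sub _ _
  unfold IsReflection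
  rw [hker]
  constructor
  · intro h
    have hr := LinearMap.finrank_range_add_finrank_ker ((t : V →ₗ[ℂ] V) - LinearMap.id)
    obtain ⟨⟨a, ha⟩, ha0, hspan⟩ := finrank_eq_one_iff'.mp (show finrank ℂ
      (LinearMap.range ((t : V →ₗ[ℂ] V) - LinearMap.id)) = 1 by omega)
    have ha0' : a ≠ 0 := fun h => ha0 (Subtype.ext h)
    obtain ⟨g, hg⟩ := Projective.exists_dual_eq_one ℂ ha0'
    refine ⟨a, g ∘ₗ ((t : V →ₗ[ℂ] V) - LinearMap.id), ha0', ?_, ?_⟩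
    · obtain ⟨v, hv⟩ := ha
      intro h
      have := LinearMap.congr_fun h v
      rw [LinearMap.comp_apply, hv, hg] at this
      exact one_ne_zero this
    · intro v
      obtain ⟨c, hc⟩ := hspan ⟨_, LinearMap.mem_range_self ((t : V →ₗ[ℂ] V) - LinearMap.id) v⟩
      have hc' : c • a = t v - v := congrArg Subtype.val hc
      have : g (t v - v) • a = t v - v := by rw [← hc', map_smul, hg, smul_eq_mul, mul_one]
      change t v = v + g (t v - v) • a
      rw [this, add_sub_cancel]
  · rintro ⟨a, f, ha, hf, h⟩
    have : LinearMap.ker ((t : V →ₗ[ℂ] V) - LinearMap.id) = LinearMap.ker f := by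
      ext v
      simp [h, ha]
    rw [this]
    exact Dual.finrank_ker_add_one_of_ne_zero hf

/-- A reflection of finite order is not a transvection. -/
lemma apply_root_ne_zero {W : Subgroup (V ≃ₗ[ℂ] V)} [Finite W] {t : V ≃ₗ[ℂ] V} (htW : t ∈ W)
    {a : V} {f : Dual ℂ V} (ha : a ≠ 0) (hf : f ≠ 0) (ht : ∀ v, t v = v + f v • a) :
    f a ≠ 0 := by
  intro h
  obtain ⟨m, hm, hm1⟩ := isOfFinOrder_iff_pow_eq_one.mp (isOfFinOrder_of_finite (⟨t, htW⟩ : W))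
  -- If f(a) = 0 the powers of t are 1 + k(f ⊗ a), which never return to 1 in characteristic zero.
  have hpow : ∀ (k : ℕ) (v : V), (t ^ k) v = v + (k * f v) • a := by
    intro k v
    induction k with
    | zero => simp
    | succ k ih =>
      rw [pow_succ', LinearEquiv.mul_apply, ih, ht]
      simp [h]
      module
  have hm1' : t ^ m = 1 := congrArg Subtype.val hm1
  apply hf
  ext v
  have := hpow m v
  rw [hm1'] at this
  simpa [ha, hm.ne'] using this

/-- Every subspace stable under a finite group has a stable complement. -/
lemma exists_stable_isCompl {W : Subgroup (V ≃ₗ[ℂ] V)} [Finite W] {U : Submodule ℂ V}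
    (hU : ∀ g ∈ W, ∀ v ∈ U, g v ∈ U) :
    ∃ U' : Submodule ℂ V, IsCompl U U' ∧ ∀ g ∈ W, ∀ v ∈ U', g v ∈ U' := by
  let ρ : Representation ℂ W V :=
    { toFun := fun g => (g : V ≃ₗ[ℂ] V).toLinearMap
      map_one' := rfl
      map_mul' := fun _ _ => rfl }
  -- The hypothesis of Maschke's theorem, from which semisimplicity is inferred.
  have : NeZero (Nat.card W : ℂ) := ⟨by exact_mod_cast Nat.card_pos.ne'⟩
  have : Representation.IsSemisimpleRepresentation ρ := inferInstance
  obtain ⟨S, hS⟩ := this.exists_isCompl ⟨U, fun g v hv => hU g g.2 v hv⟩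
  refine ⟨S.toSubmodule, IsCompl.of_eq ?_ ?_, fun g hg v hv => S.apply_mem_toSubmodule ⟨g, hg⟩ hv⟩
  · exact congrArg Subrepresentation.toSubmodule hS.inf_eq_bot
  · exact congrArg Subrepresentation.toSubmodule hS.sup_eq_top

/-! ### Products of groups along V = U ⊕ U' -/

section Product

variable {U U' : Submodule ℂ V}

/-- The automorphism `g₁ ⊕ g₂` of `V = U ⊕ U'`. -/
def glSum (h : IsCompl U U') (g : U ≃ₗ[ℂ] U) (g' : U' ≃ₗ[ℂ] U') : V ≃ₗ[ℂ] V :=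
  (U.prodEquivOfIsCompl U' h).symm ≪≫ₗ (g.prodCongr g') ≪≫ₗ U.prodEquivOfIsCompl U' h

lemma glSum_apply_left (h : IsCompl U U') (g : U ≃ₗ[ℂ] U) (g' : U' ≃ₗ[ℂ] U') (x : U) :
    glSum h g g' x = g x := by
  simp [glSum]

lemma glSum_apply_right (h : IsCompl U U') (g : U ≃ₗ[ℂ] U) (g' : U' ≃ₗ[ℂ] U') (x : U') :
    glSum h g g' x = g' x := by
  simp [glSum]

lemma equiv_ext_of_isCompl (h : IsCompl U U') {s t : V ≃ₗ[ℂ] V} (h₁ : ∀ x : U, s x = t x)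
    (h₂ : ∀ x : U', s x = t x) : s = t := by
  ext v
  obtain ⟨x, y, rfl⟩ : ∃ (x : U) (y : U'), (x : V) + y = v := by
    have : v ∈ U ⊔ U' := h.sup_eq_top ▸ Submodule.mem_top
    obtain ⟨x, hx, y, hy, rfl⟩ := Submodule.mem_sup.mp this
    exact ⟨⟨x, hx⟩, ⟨y, hy⟩, rfl⟩
  rw [map_add, map_add, h₁, h₂]

lemma glSum_mul (h : IsCompl U U') (g k : U ≃ₗ[ℂ] U) (g' k' : U' ≃ₗ[ℂ] U') :
    glSum h (g * k) (g' * k') = glSum h g g' * glSum h k k' := by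
  refine equiv_ext_of_isCompl h (fun x => ?_) fun x => ?_
  · simp [LinearEquiv.mul_apply, glSum_apply_left]
  · simp [LinearEquiv.mul_apply, glSum_apply_right]

lemma glSum_one (h : IsCompl U U') : glSum h 1 1 = 1 := by
  refine equiv_ext_of_isCompl h (fun x => ?_) fun x => ?_
  · simp [glSum_apply_left]
  · simp [glSum_apply_right]

/-- The embedding `g ↦ g ⊕ 1` of `GL(U)` into `GL(V)`. -/
def glInl (h : IsCompl U U') : (U ≃ₗ[ℂ] U) →* (V ≃ₗ[ℂ] V) where
  toFun g := glSum h g 1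
  map_one' := glSum_one h
  map_mul' g k := by rw [← glSum_mul, one_mul]

lemma glInl_injective (h : IsCompl U U') : Function.Injective (glInl h) := fun g k e => by
  ext x
  rw [← glSum_apply_left h g 1, ← glSum_apply_left h k 1]
  exact congrArg (fun t : V ≃ₗ[ℂ] V => t x) e

lemma glSum_swap (h : IsCompl U U') (g : U ≃ₗ[ℂ] U) (g' : U' ≃ₗ[ℂ] U') :
    glSum h.symm g' g = glSum h g g' :=
  equiv_ext_of_isCompl h
    (fun x => by rw [glSum_apply_left, glSum_apply_right])
    (fun x => by rw [glSum_apply_left, glSum_apply_right])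

lemma glSum_eq_mul (h : IsCompl U U') (g : U ≃ₗ[ℂ] U) (g' : U' ≃ₗ[ℂ] U') :
    glSum h g g' = glInl h g * glInl h.symm g' := by
  change _ = glSum h g 1 * glSum h.symm g' 1
  rw [glSum_swap h, ← glSum_mul, mul_one, one_mul]

/-- The group generated by the reflections of `U` which, extended by the identity on `U'`,
lie in `W`. -/
def reflectionSubgroup (W : Subgroup (V ≃ₗ[ℂ] V)) (h : IsCompl U U') : Subgroup (U ≃ₗ[ℂ] U) :=
  Subgroup.closure {t | IsReflection t ∧ glInl h t ∈ W}

lemma glInl_mem {W : Subgroup (V ≃ₗ[ℂ] V)} (h : IsCompl U U') {g : U ≃ₗ[ℂ] U}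
    (hg : g ∈ reflectionSubgroup W h) : glInl h g ∈ W := by
  have : reflectionSubgroup W h ≤ W.comap (glInl h) :=
    (Subgroup.closure_le _).mpr fun t ht => ht.2
  exact this hg

/-- Finiteness holds because extension by the identity embeds this group into W. -/
lemma isComplexReflectionGroup_reflectionSubgroup (W : Subgroup (V ≃ₗ[ℂ] V)) [Finite W]
    (h : IsCompl U U') : IsComplexReflectionGroup (reflectionSubgroup W h) where
  finite := Finite.of_injective
    (fun g : reflectionSubgroup W h => (⟨glInl h g, glInl_mem h g.2⟩ : W)) fun _ _ e =>
      Subtype.ext (glInl_injective h (congrArg Subtype.val e))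
  generated := le_antisymm ((Subgroup.closure_le _).mpr fun _ ht => ht.1)
    (Subgroup.closure_mono fun _ ht => ⟨Subgroup.subset_closure ht, ht.1⟩)

/-- A reflection whose root lies in `U` and whose hyperplane contains `U'` comes from a reflection
of `U`. -/
lemma exists_glInl_eq [FiniteDimensional ℂ V] (h : IsCompl U U') {t : V ≃ₗ[ℂ] V} {a : V}
    {f : Dual ℂ V} (ha : a ≠ 0) (hf : f ≠ 0) (ht : ∀ v, t v = v + f v • a) (haU : a ∈ U)
    (hfU : ∀ v ∈ U', f v = 0) : ∃ s : U ≃ₗ[ℂ] U, IsReflection s ∧ glInl h s = t := by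
  have hs : ∀ v ∈ U, (t : V →ₗ[ℂ] V) v ∈ U := fun v hv => by
    change t v ∈ U
    rw [ht]
    exact U.add_mem hv (U.smul_mem _ haU)
  let s : U ≃ₗ[ℂ] U := LinearEquiv.ofInjectiveEndo ((t : V →ₗ[ℂ] V).restrict hs)
    fun x y e => Subtype.ext (t.injective (congrArg Subtype.val e))
  have hst : ∀ x : U, (s x : V) = t x := fun x => by
    simp only [s]
    rfl
  have e : glInl h s = t := equiv_ext_of_isCompl h
    (fun x => (glSum_apply_left h s 1 x).trans (hst x))
    (fun x => (glSum_apply_right h s 1 x).trans (by simp [ht, hfU x x.2]))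
  refine ⟨s, (isReflection_iff s).mpr ⟨⟨a, haU⟩, f.domRestrict U, ?_, ?_, ?_⟩, e⟩
  · exact fun h => ha (congrArg Subtype.val h)
  · intro h0
    apply hf
    ext v
    have : v ∈ U ⊔ U' := h.sup_eq_top ▸ Submodule.mem_top
    obtain ⟨x, hx, y, hy, rfl⟩ := Submodule.mem_sup.mp this
    rw [map_add, hfU y hy, add_zero]
    exact LinearMap.congr_fun h0 ⟨x, hx⟩
  · intro v
    exact Subtype.ext ((hst v).trans (ht v))

end Product

/-! ### From W-invariance to gl(V)-invariance -/

/-- An irreducible complex reflection group acts irreducibly: a subspace stable under its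
reflections is trivial. -/
theorem eq_bot_or_eq_top_of_stable [FiniteDimensional ℂ V] {W : Subgroup (V ≃ₗ[ℂ] V)}
    (hW : IsComplexReflectionGroup W) (hirr : IsIrreducible W) {U : Submodule ℂ V}
    (hU : ∀ t ∈ W, IsReflection t → ∀ v ∈ U, t v ∈ U) : U = ⊥ ∨ U = ⊤ := by
  have := hW.finite
  have hU' : ∀ g ∈ W, ∀ v ∈ U, g v ∈ U := by
    intro g hg
    have hg' : g ∈ Subgroup.closure {t : V ≃ₗ[ℂ] V | t ∈ W ∧ IsReflection t} := by
      rwa [hW.generated]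
    -- Equality of U with its image, rather than inclusion, is propagated so that inverses are
    -- covered; for a reflection it follows by comparing dimensions.
    suffices W ≤ Subgroup.closure {t : V ≃ₗ[ℂ] V | t ∈ W ∧ IsReflection t} ∧
        (Subgroup.closure {t : V ≃ₗ[ℂ] V | t ∈ W ∧ IsReflection t} : Set (V ≃ₗ[ℂ] V)) ⊆
          {g | U.map (g : V →ₗ[ℂ] V) = U} by
      intro v hv
      have h : U.map (g : V →ₗ[ℂ] V) = U := this.2 hg'
      rw [← h]
      exact Submodule.mem_map_of_mem hv
    refine ⟨hW.generated.ge, fun g hg => ?_⟩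
    induction hg using Subgroup.closure_induction with
    | mem t ht =>
      refine Submodule.eq_of_le_of_finrank_eq ?_ (t.finrank_map_eq U)
      rintro _ ⟨v, hv, rfl⟩
      exact hU t ht.1 ht.2 v hv
    | one => exact Submodule.map_id U
    | mul x y _ _ hx hy =>
      change U.map ((x : V →ₗ[ℂ] V) ∘ₗ (y : V →ₗ[ℂ] V)) = U
      rw [Submodule.map_comp, hy, hx]
    | inv x _ hx =>
      change U.map ((x.symm : V ≃ₗ[ℂ] V) : V →ₗ[ℂ] V) = U
      nth_rewrite 1 [← show U.map (x : V →ₗ[ℂ] V) = U from hx]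
      rw [← Submodule.map_comp]
      simp
  obtain ⟨U', hc, hU''⟩ := exists_stable_isCompl hU'
  have hprod : IsProductOf W (reflectionSubgroup W hc) (reflectionSubgroup W hc.symm) := by
    intro g
    constructor
    · intro hg
      rw [← hW.generated] at hg
      suffices h : ∃ g₁ ∈ reflectionSubgroup W hc, ∃ g₂ ∈ reflectionSubgroup W hc.symm,
          g = glSum hc g₁ g₂ by
        obtain ⟨g₁, h₁, g₂, h₂, rfl⟩ := h
        exact ⟨g₁, h₁, g₂, h₂, glSum_apply_left hc g₁ g₂, glSum_apply_right hc g₁ g₂⟩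
      induction hg using Subgroup.closure_induction with
      | one => exact ⟨1, one_mem _, 1, one_mem _, (glSum_one hc).symm⟩
      | mul x y _ _ hx hy =>
        obtain ⟨g₁, h₁, g₂, h₂, rfl⟩ := hx
        obtain ⟨k₁, l₁, k₂, l₂, rfl⟩ := hy
        exact ⟨_, mul_mem h₁ l₁, _, mul_mem h₂ l₂, (glSum_mul hc _ _ _ _).symm⟩
      | inv x _ hx =>
        obtain ⟨g₁, h₁, g₂, h₂, rfl⟩ := hx
        refine ⟨_, inv_mem h₁, _, inv_mem h₂, inv_eq_of_mul_eq_one_right ?_⟩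
        rw [← glSum_mul, mul_inv_cancel, mul_inv_cancel, glSum_one]
      | mem t ht =>
        obtain ⟨a, f, ha, hf, hta⟩ := (isReflection_iff t).mp ht.2
        -- Since t v - v = f(v)a, a stable subspace lies in the hyperplane or contains the root. For
        -- complementary U and U', exactly one contains the root and the other lies in the
        -- hyperplane.
        have key : ∀ S : Submodule ℂ V, (∀ v ∈ S, t v ∈ S) → (∀ v ∈ S, f v = 0) ∨ a ∈ S := by
          intro S hS
          by_contra! hcon
          obtain ⟨⟨v, hv, hfv⟩, haS⟩ := hcon
          have h := S.sub_mem (hS v hv) hv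
          rw [hta, add_sub_cancel_left] at h
          exact haS ((S.smul_mem_iff hfv).mp h)
        rcases key U (hU' t ht.1) with h | h
        · have haU' : a ∈ U' := by
            refine (key U' (hU'' t ht.1)).resolve_left fun h' => hf ?_
            ext v
            have : v ∈ U ⊔ U' := hc.sup_eq_top ▸ Submodule.mem_top
            obtain ⟨x, hx, y, hy, rfl⟩ := Submodule.mem_sup.mp this
            simp [h x hx, h' y hy]
          obtain ⟨s, hs, rfl⟩ := exists_glInl_eq hc.symm ha hf hta haU' h
          refine ⟨1, one_mem _, s, Subgroup.subset_closure ⟨hs, ht.1⟩, ?_⟩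
          exact glSum_swap hc 1 s
        · have hfU' : ∀ v ∈ U', f v = 0 := by
            refine (key U' (hU'' t ht.1)).resolve_right fun h' => ha ?_
            exact (Submodule.disjoint_def.mp hc.disjoint) a h h'
          obtain ⟨s, hs, rfl⟩ := exists_glInl_eq hc ha hf hta h hfU'
          exact ⟨s, Subgroup.subset_closure ⟨hs, ht.1⟩, 1, one_mem _, rfl⟩
    · rintro ⟨g₁, h₁, g₂, h₂, e₁, e₂⟩
      have : g = glSum hc g₁ g₂ := equiv_ext_of_isCompl hc
        (fun x => (e₁ x).trans (glSum_apply_left hc g₁ g₂ x).symm)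
        (fun x => (e₂ x).trans (glSum_apply_right hc g₁ g₂ x).symm)
      rw [this, glSum_eq_mul]
      exact mul_mem (glInl_mem hc h₁) (glInl_mem hc.symm h₂)
  rcases hirr U U' hc _ _ (isComplexReflectionGroup_reflectionSubgroup W hc)
    (isComplexReflectionGroup_reflectionSubgroup W hc.symm) hprod with h | h
  · exact Or.inl h
  · right
    have := hc.sup_eq_top
    rwa [h, sup_bot_eq] at this

/-- For an irreducible reflection group, every `W`-invariant of `⋀(V ⊕ V*)` is killed by
`gl(V)`. The group has to contain a reflection. -/
theorem rankOneDer_eq_zero [FiniteDimensional ℂ V] {W : Subgroup (V ≃ₗ[ℂ] V)}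
    (hW : IsComplexReflectionGroup W) (hirr : IsIrreducible W) {s : V ≃ₗ[ℂ] V} (hsW : s ∈ W)
    (hs : IsReflection s) {x : Ext V} (hx : ∀ g ∈ W, act g x = x) (a : V) (f : Dual ℂ V) :
    rankOneDer a f x = 0 := by
  have := hW.finite
  have hroot : ∀ t ∈ W, IsReflection t → ∃ (b : V) (h : Dual ℂ V), b ≠ 0 ∧ h ≠ 0 ∧ h b ≠ 0 ∧
      (∀ v, t v = v + h v • b) ∧ rankOneDer b h x = 0 := by
    intro t htW ht
    obtain ⟨b, h, hb, hh, hbh⟩ := (isReflection_iff t).mp ht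
    have hhb := apply_root_ne_zero htW hb hh hbh
    exact ⟨b, h, hb, hh, hhb, hbh, rankOneDer_eq_zero_of_act hbh hhb (hx t htW)⟩
  obtain ⟨b₀, h₀, hb₀, hh₀, -, -, hz₀⟩ := hroot s hsW hs
  have hright : ∀ g, rankOneDer b₀ g x = 0 := by
    -- The common kernel of the forms in S is stable: for g in S also g(b)h is in S, so g vanishes
    -- on t v whenever v is in that kernel. It is not V because h₀ ≠ 0 lies in S, so it is 0 and S
    -- is everything.
    let S : Submodule ℂ (Dual ℂ V) :=
      { carrier := {g | rankOneDer b₀ g x = 0}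
        add_mem' := fun {g h} hg hh => by
          simp only [Set.mem_ofPred_eq] at hg hh ⊢
          rw [rankOneDer_add_right, LinearMap.add_apply, hg, hh, add_zero]
        zero_mem' := by simp [rankOneDer_apply]
        smul_mem' := fun c g hg => by
          simp only [Set.mem_ofPred_eq] at hg ⊢
          rw [rankOneDer_smul_right, LinearMap.smul_apply, hg, smul_zero] }
    have hstable : ∀ t ∈ W, IsReflection t → ∀ v ∈ S.dualCoannihilator,
        t v ∈ S.dualCoannihilator := by
      intro t htW ht v hv
      obtain ⟨b, h, -, -, hhb, hth, hz⟩ := hroot t htW ht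
      rw [Submodule.mem_dualCoannihilator] at hv ⊢
      intro g hg
      have h' := hv _ (show g b • h ∈ S from (rankOneDer_mixed hhb hg hz).2)
      rw [hth, map_add, hv g hg, map_smul, smul_eq_mul, zero_add, mul_comm]
      exact h'
    have hS : S = ⊤ := by
      rcases eq_bot_or_eq_top_of_stable hW hirr hstable with h | h
      · rw [← Subspace.dualCoannihilator_dualAnnihilator_eq (W := S), h,
          Submodule.dualAnnihilator_bot]
      · exfalso
        apply hh₀
        ext v
        have hv : v ∈ S.dualCoannihilator := h ▸ Submodule.mem_top
        exact (Submodule.mem_dualCoannihilator _).mp hv h₀ hz₀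
    intro g
    have : g ∈ S := hS ▸ Submodule.mem_top
    exact this
  -- The same argument in the vector variable; b₀ in T excludes T = 0.
  let T : Submodule ℂ V :=
    { carrier := {c | ∀ g, rankOneDer c g x = 0}
      add_mem' := fun {c d} hc hd g => by
        rw [rankOneDer_add_left, LinearMap.add_apply, hc, hd, add_zero]
      zero_mem' := fun g => by simp [rankOneDer_apply]
      smul_mem' := fun r c hc g => by
        rw [rankOneDer_smul_left, LinearMap.smul_apply, hc, smul_zero] }
  have hT : T = ⊤ := by
    refine (eq_bot_or_eq_top_of_stable hW hirr (U := T) fun t htW ht v hv g => ?_).resolve_left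
      fun h => ?_
    · obtain ⟨b, h, -, -, hhb, hth, hz⟩ := hroot t htW ht
      rw [hth, rankOneDer_add_left, LinearMap.add_apply, hv g, zero_add]
      exact (rankOneDer_mixed hhb (hv g) hz).1
    · have : b₀ ∈ T := hright
      rw [h] at this
      exact hb₀ this
  have : a ∈ T := hT ▸ Submodule.mem_top
  exact this f

/-- A nontrivial irreducible reflection group, or one in rank at least two, contains a
reflection. -/
lemma exists_reflection [FiniteDimensional ℂ V] {W : Subgroup (V ≃ₗ[ℂ] V)}
    (hW : IsComplexReflectionGroup W) (hirr : IsIrreducible W) (h0 : finrank ℂ V ≠ 0)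
    (hne : finrank ℂ V = 1 → W ≠ ⊥) : ∃ s ∈ W, IsReflection s := by
  by_contra! hcon
  have hset : {t : V ≃ₗ[ℂ] V | t ∈ W ∧ IsReflection t} = ∅ := by
    ext t
    simpa using hcon t
  have hbot : W = ⊥ := by rw [← hW.generated, hset, Subgroup.closure_empty]
  have h2 : finrank ℂ V ≠ 1 := fun h => hne h hbot
  have : Nontrivial V := Module.nontrivial_of_finrank_pos (R := ℂ) (by omega)
  obtain ⟨v, hv⟩ := exists_ne (0 : V)
  -- Without reflections every line is stable vacuously, which forces dimension one.
  rcases eq_bot_or_eq_top_of_stable hW hirr (U := Submodule.span ℂ {v})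
    (fun t ht ht' => absurd ht' (hcon t ht)) with h | h
  · exact hv (Submodule.span_singleton_eq_bot.mp h)
  · have := finrank_span_singleton (K := ℂ) hv
    rw [h, finrank_top] at this
    exact h2 this

/-! ### The bigrading -/

lemma extPiece_eq (i j : ℕ) :
    extPiece V i j = LinearMap.range (vec (V := V)) ^ i * LinearMap.range (covec (V := V)) ^ j :=
  rfl

/-- Vectors and covectors anticommute, and signs do not matter for products of subspaces. -/
lemma commute_range_covec_range_vec :
    Commute (LinearMap.range (covec (V := V))) (LinearMap.range (vec (V := V))) := by
  have h : ∀ (v : V) (φ : Dual ℂ V), (vec v : Ext V) * covec φ = -(covec φ * vec v) :=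
    fun v φ => by simpa using vec_mul_covec_mul v φ 1
  refine le_antisymm (Submodule.mul_le.mpr ?_) (Submodule.mul_le.mpr ?_)
  · rintro _ ⟨φ, rfl⟩ _ ⟨v, rfl⟩
    rw [← neg_neg (covec φ * vec v), ← h]
    exact neg_mem (Submodule.mul_mem_mul ⟨v, rfl⟩ ⟨φ, rfl⟩)
  · rintro _ ⟨v, rfl⟩ _ ⟨φ, rfl⟩
    rw [h]
    exact neg_mem (Submodule.mul_mem_mul ⟨φ, rfl⟩ ⟨v, rfl⟩)

lemma vec_mul_mem_extPiece (v : V) {i j : ℕ} {x : Ext V} (hx : x ∈ extPiece V i j) :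
    vec v * x ∈ extPiece V (i + 1) j := by
  rw [extPiece_eq, pow_succ', mul_assoc]
  exact Submodule.mul_mem_mul ⟨v, rfl⟩ hx

lemma covec_mul_mem_extPiece (φ : Dual ℂ V) {i j : ℕ} {x : Ext V} (hx : x ∈ extPiece V i j) :
    covec φ * x ∈ extPiece V i (j + 1) := by
  rw [extPiece_eq, pow_succ', ← mul_assoc,
    ← (commute_range_covec_range_vec.pow_right i).eq, mul_assoc]
  exact Submodule.mul_mem_mul ⟨φ, rfl⟩ hx

lemma extPiece_zero : extPiece V 0 0 = Submodule.span ℂ {1} := by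
  rw [extPiece_eq, pow_zero, pow_zero, one_mul, Submodule.one_eq_span]

/-- A derivation which is diagonal on `V ⊕ V*` is diagonal with respect to the bigrading. -/
lemma IsDer.apply_extPiece {T : End ℂ (Ext V)} {α β : ℂ}
    (hT : IsDer T (LinearMap.prodMap (α • LinearMap.id) (β • LinearMap.id))) {i j : ℕ} {x : Ext V}
    (hx : x ∈ extPiece V i j) : T x = (i * α + j * β) • x := by
  have hA : ∀ (S : Submodule ℂ (Ext V)) (c : ℂ), S ≤ T.eigenspace c →
      LinearMap.range vec * S ≤ T.eigenspace (c + α) := by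
    intro S c hS
    rw [Submodule.mul_le]
    rintro _ ⟨v, rfl⟩ y hy
    have hy' := End.mem_eigenspace_iff.mp (hS hy)
    rw [End.mem_eigenspace_iff]
    have := hT.map_ι_mul (v, 0) y
    simp only [ι_eq, hy'] at this
    simp only [map_zero, add_zero, LinearMap.prodMap_apply, LinearMap.smul_apply,
      LinearMap.id_apply, map_smul, smul_mul_assoc, mul_smul_comm] at this
    rw [this]; module
  have hB : ∀ (S : Submodule ℂ (Ext V)) (c : ℂ), S ≤ T.eigenspace c →
      LinearMap.range covec * S ≤ T.eigenspace (c + β) := by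
    intro S c hS
    rw [Submodule.mul_le]
    rintro _ ⟨v, rfl⟩ y hy
    have hy' := End.mem_eigenspace_iff.mp (hS hy)
    rw [End.mem_eigenspace_iff]
    have := hT.map_ι_mul (0, v) y
    simp only [ι_eq, hy'] at this
    simp only [map_zero, zero_add, LinearMap.prodMap_apply, LinearMap.smul_apply,
      LinearMap.id_apply, map_smul, smul_mul_assoc, mul_smul_comm] at this
    rw [this]; module
  have h0 : ∀ j : ℕ, LinearMap.range (covec (V := V)) ^ j ≤ T.eigenspace (j * β) := by
    intro j
    induction j with
    | zero =>
      rw [pow_zero, Submodule.one_le]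
      simp [hT.map_one]
    | succ j ih =>
      rw [pow_succ']
      rw [show ((j + 1 : ℕ) : ℂ) * β = j * β + β by push_cast; ring]
      exact hB _ _ ih
  have h1 : ∀ i : ℕ, extPiece V i j ≤ T.eigenspace (i * α + j * β) := by
    intro i
    induction i with
    | zero => simpa [extPiece_eq] using h0 j
    | succ i ih =>
      rw [extPiece_eq, pow_succ', mul_assoc]
      rw [show ((i + 1 : ℕ) : ℂ) * α + j * β = i * α + j * β + α by push_cast; ring]
      exact hA _ _ ih
  exact End.mem_eigenspace_iff.mp (h1 i hx)

lemma finrank_mul_le {A : Type*} [Ring A] [Algebra ℂ A] [FiniteDimensional ℂ A]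
    (P Q : Submodule ℂ A) : finrank ℂ ↥(P * Q) ≤ finrank ℂ P * finrank ℂ Q := by
  rw [← Submodule.mulMap_range, ← finrank_tensorProduct]
  exact LinearMap.finrank_range_le _

lemma finrank_finset_iSup_le {ι M : Type*} [AddCommGroup M] [Module ℂ M] [FiniteDimensional ℂ M]
    (s : Finset ι) (E : ι → Submodule ℂ M) :
    finrank ℂ ↥(⨆ p ∈ s, E p) ≤ ∑ p ∈ s, finrank ℂ (E p) := by
  classical
  induction s using Finset.induction_on with
  | empty => simp
  | insert p s hp ih =>
    rw [Finset.iSup_insert, Finset.sum_insert hp]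
    exact (Submodule.finrank_add_le_finrank_add_finrank _ _).trans (by gcongr)

/-- The power is the image of the i-th exterior power of M under the algebra map induced by `f`. -/
lemma finrank_range_ι_comp_pow_le {M : Type*} [AddCommGroup M] [Module ℂ M] [FiniteDimensional ℂ M]
    (f : M →ₗ[ℂ] V × Dual ℂ V) (i : ℕ) :
    finrank ℂ ↥(LinearMap.range (ExteriorAlgebra.ι ℂ ∘ₗ f) ^ i) ≤ (finrank ℂ M).choose i := by
  have h : LinearMap.range (ExteriorAlgebra.ι ℂ ∘ₗ f) ^ i =
      (ExteriorAlgebra.exteriorPower ℂ i M).map (ExteriorAlgebra.map f).toLinearMap := by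
    rw [ExteriorAlgebra.exteriorPower, Submodule.map_pow, ← LinearMap.range_comp]
    congr 2
    ext m
    simp
  rw [h, ← exteriorPower.finrank_eq ℂ i]
  exact Submodule.finrank_map_le _ _

/-! ### Dimensions of the bihomogeneous components -/

section FiniteDimensional

variable [FiniteDimensional ℂ V]

/-- A basis of `⋀(V ⊕ V*)`. -/
def extBasis (V : Type*) [AddCommGroup V] [Module ℂ V] [FiniteDimensional ℂ V] :
    Basis (Finset (Fin (2 * finrank ℂ V))) ℂ (Ext V) :=
  (finBasisOfFinrankEq ℂ (V × Dual ℂ V)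
    (by rw [finrank_prod, Subspace.dual_finrank_eq, two_mul])).ExteriorAlgebra

instance finiteDimensional_ext : FiniteDimensional ℂ (Ext V) :=
  (extBasis V).finiteDimensional_of_finite

lemma finrank_ext : finrank ℂ (Ext V) = 2 ^ finrank ℂ V * 2 ^ finrank ℂ V := by
  rw [finrank_eq_card_basis (extBasis V), Fintype.card_finset,
    Fintype.card_fin, two_mul, pow_add]

lemma finrank_extPiece_le (i j : ℕ) :
    finrank ℂ (extPiece V i j) ≤ (finrank ℂ V).choose i * (finrank ℂ V).choose j := by
  refine (finrank_mul_le _ _).trans (Nat.mul_le_mul (finrank_range_ι_comp_pow_le _ i) ?_)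
  conv_rhs => rw [← Subspace.dual_finrank_eq]
  exact finrank_range_ι_comp_pow_le _ j

lemma extPiece_eq_bot {i j : ℕ} (h : finrank ℂ V < i ∨ finrank ℂ V < j) :
    extPiece V i j = ⊥ := by
  have := finrank_extPiece_le (V := V) i j
  rw [← Submodule.finrank_eq_zero (R := ℂ)]
  rcases h with h | h <;> simpa [Nat.choose_eq_zero_of_lt h] using this

/-- The pairs of degrees in which `⋀(V ⊕ V*)` lives. -/
def bidegrees (V : Type*) [AddCommGroup V] [Module ℂ V] : Finset (ℕ × ℕ) :=
  Finset.range (finrank ℂ V + 1) ×ˢ Finset.range (finrank ℂ V + 1)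

lemma extPiece_eq_bot_of_notMem {p : ℕ × ℕ} (h : p ∉ bidegrees V) :
    extPiece V p.1 p.2 = ⊥ := by
  refine extPiece_eq_bot ?_
  simp only [bidegrees, Finset.mem_product, Finset.mem_range] at h
  omega

lemma extPiece_le_iSup (i j : ℕ) :
    extPiece V i j ≤ ⨆ p ∈ bidegrees V, extPiece V p.1 p.2 := by
  by_cases h : (i, j) ∈ bidegrees V
  · exact le_iSup₂_of_le (i, j) h le_rfl
  · rw [extPiece_eq_bot_of_notMem h]
    exact bot_le

lemma iSup_extPiece : ⨆ p ∈ bidegrees V, extPiece V p.1 p.2 = ⊤ := by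
  rw [eq_top_iff]
  rintro x -
  induction x using ext_induction with
  | one =>
    refine extPiece_le_iSup 0 0 ?_
    rw [extPiece_zero]
    exact Submodule.mem_span_singleton_self 1
  | smul c x hx => exact Submodule.smul_mem _ _ hx
  | add x y hx hy => exact add_mem hx hy
  | ι_mul m x hx =>
    obtain ⟨y, rfl⟩ := (Submodule.mem_iSup_finset_iff_exists_sum _ _).mp hx
    rw [Finset.mul_sum]
    refine sum_mem fun p _ => ?_
    rw [ι_eq, add_mul]
    exact add_mem (extPiece_le_iSup _ _ (vec_mul_mem_extPiece _ (y p).2))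
      (extPiece_le_iSup _ _ (covec_mul_mem_extPiece _ (y p).2))

/-- The components span, and their upper bounds add up to the dimension 4ⁿ of the whole algebra, so
every bound is attained. -/
theorem finrank_extPiece (i j : ℕ) :
    finrank ℂ (extPiece V i j) = (finrank ℂ V).choose i * (finrank ℂ V).choose j := by
  by_cases h : (i, j) ∈ bidegrees V
  · have hle : ∀ p ∈ bidegrees V, finrank ℂ (extPiece V p.1 p.2) ≤
        (finrank ℂ V).choose p.1 * (finrank ℂ V).choose p.2 :=
      fun p _ => finrank_extPiece_le p.1 p.2
    have hsum : ∑ p ∈ bidegrees V, (finrank ℂ V).choose p.1 * (finrank ℂ V).choose p.2 =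
        finrank ℂ (Ext V) := by
      rw [bidegrees, Finset.sum_product, finrank_ext, ← Nat.sum_range_choose,
        Finset.sum_mul_sum]
    have htop : finrank ℂ (Ext V) ≤ ∑ p ∈ bidegrees V, finrank ℂ (extPiece V p.1 p.2) := by
      have := finrank_finset_iSup_le (bidegrees V) fun p => extPiece V p.1 p.2
      rwa [iSup_extPiece, finrank_top] at this
    exact (Finset.sum_eq_sum_iff_of_le hle).mp
      (le_antisymm (Finset.sum_le_sum hle) (hsum.trans_le htop)) (i, j) h
  · rw [extPiece_eq_bot_of_notMem h, finrank_bot]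
    simp only [bidegrees, Finset.mem_product, Finset.mem_range] at h
    rcases (by omega : finrank ℂ V < i ∨ finrank ℂ V < j) with h | h <;>
      simp [Nat.choose_eq_zero_of_lt h]

/-! ### Degree operators and projections -/

/-- The derivation acting on a component as multiplication by its `V`-degree. -/
def vecDegree : End ℂ (Ext V) :=
  ∑ i, LinearMap.mulLeft ℂ (vec (finBasis ℂ V i)) * dVec ((finBasis ℂ V).coord i)

/-- The derivation acting on a component as multiplication by its `V*`-degree. -/
def covecDegree : End ℂ (Ext V) :=
  ∑ i, LinearMap.mulLeft ℂ (covec ((finBasis ℂ V).coord i)) * dCovec (finBasis ℂ V i)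

/-- The invariant element of bidegree `(1, 1)`. -/
def lefschetz (V : Type*) [AddCommGroup V] [Module ℂ V] [FiniteDimensional ℂ V] : Ext V :=
  ∑ i, vec (finBasis ℂ V i) * covec ((finBasis ℂ V).coord i)

/-- The adjoint of multiplication by the Lefschetz element. -/
def dualLefschetz : End ℂ (Ext V) :=
  ∑ i, dVec ((finBasis ℂ V).coord i) * dCovec (finBasis ℂ V i)

lemma vecDegree_apply (x : Ext V) : vecDegree x =
    ∑ i, vec (finBasis ℂ V i) * dVec ((finBasis ℂ V).coord i) x := by
  simp [vecDegree]

lemma covecDegree_apply (x : Ext V) : covecDegree x =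
    ∑ i, covec ((finBasis ℂ V).coord i) * dCovec (finBasis ℂ V i) x := by
  simp [covecDegree]

lemma dualLefschetz_apply (x : Ext V) : dualLefschetz x =
    ∑ i, dVec ((finBasis ℂ V).coord i) (dCovec (finBasis ℂ V i) x) := by
  simp [dualLefschetz]

lemma lefschetz_mul (x : Ext V) : lefschetz V * x =
    ∑ i, vec (finBasis ℂ V i) * (covec ((finBasis ℂ V).coord i) * x) := by
  simp [lefschetz, Finset.sum_mul, mul_assoc]

lemma sum_coord_smul (v : V) : ∑ i, (finBasis ℂ V).coord i v • finBasis ℂ V i = v :=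
  (finBasis ℂ V).sum_repr v

lemma sum_apply_smul_coord (φ : Dual ℂ V) :
    ∑ i, φ (finBasis ℂ V i) • (finBasis ℂ V).coord i = φ := by
  refine (finBasis ℂ V).ext fun j => ?_
  simp

lemma isDer_vecDegree : IsDer (vecDegree (V := V))
    (LinearMap.prodMap ((1 : ℂ) • LinearMap.id) ((0 : ℂ) • LinearMap.id)) := by
  have h := IsDer.sum (V := V) Finset.univ fun i _ =>
    isDer_vec_dVec (finBasis ℂ V i) ((finBasis ℂ V).coord i)
  have e : LinearMap.prodMap ((1 : ℂ) • LinearMap.id) ((0 : ℂ) • LinearMap.id) =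
      ∑ i, LinearMap.prodMap (((finBasis ℂ V).coord i).smulRight (finBasis ℂ V i))
        (0 : End ℂ (Dual ℂ V)) := by
    refine LinearMap.ext fun m => Prod.ext ?_ ?_
    · simp [Prod.fst_sum]
    · simp [Prod.snd_sum]
  rw [e]
  exact h

lemma isDer_covecDegree : IsDer (covecDegree (V := V))
    (LinearMap.prodMap ((0 : ℂ) • LinearMap.id) ((1 : ℂ) • LinearMap.id)) := by
  have h := IsDer.sum (V := V) Finset.univ fun i _ =>
    isDer_covec_dCovec (finBasis ℂ V i) ((finBasis ℂ V).coord i)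
  have e : LinearMap.prodMap ((0 : ℂ) • LinearMap.id) ((1 : ℂ) • LinearMap.id) =
      ∑ i, LinearMap.prodMap (0 : End ℂ V)
        ((Dual.eval ℂ V (finBasis ℂ V i)).smulRight ((finBasis ℂ V).coord i)) := by
    refine LinearMap.ext fun m => Prod.ext ?_ ?_
    · simp [Prod.fst_sum]
    · simp [Prod.snd_sum]
  rw [e]
  exact h

lemma vecDegree_extPiece {i j : ℕ} {x : Ext V} (hx : x ∈ extPiece V i j) :
    vecDegree x = (i : ℂ) • x := by
  simpa using isDer_vecDegree.apply_extPiece hx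

lemma covecDegree_extPiece {i j : ℕ} {x : Ext V} (hx : x ∈ extPiece V i j) :
    covecDegree x = (j : ℂ) • x := by
  simpa using isDer_covecDegree.apply_extPiece hx

/-- A derivation whose eigenspaces are the bihomogeneous components. -/
def bidegree : End ℂ (Ext V) := vecDegree + Complex.I • covecDegree

/-- The eigenvalue of `bidegree` on the component of bidegree `p`. -/
def bidegreeValue (p : ℕ × ℕ) : ℂ := p.1 + Complex.I * p.2

/-- Real and imaginary parts recover the two degrees, so one operator separates all bidegrees. -/
lemma bidegreeValue_injective : Function.Injective bidegreeValue := by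
  intro p q h
  have h₁ := congrArg Complex.re h
  have h₂ := congrArg Complex.im h
  simp only [bidegreeValue, Complex.add_re, Complex.natCast_re, Complex.mul_re, Complex.I_re,
    Complex.I_im, Complex.natCast_im, Complex.add_im, Complex.mul_im] at h₁ h₂
  ext
  · simpa using h₁
  · simpa using h₂

lemma extPiece_le_eigenspace (p : ℕ × ℕ) :
    extPiece V p.1 p.2 ≤ (bidegree (V := V)).eigenspace (bidegreeValue p) := fun x hx => by
  rw [End.mem_eigenspace_iff, bidegree, LinearMap.add_apply, LinearMap.smul_apply,
    vecDegree_extPiece hx, covecDegree_extPiece hx, bidegreeValue]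
  module

/-- The projections onto the bihomogeneous components. -/
lemma exists_projections : ∃ π : ℕ × ℕ → End ℂ (Ext V), ∀ p q : ℕ × ℕ,
    ∀ x ∈ (bidegree (V := V)).eigenspace (bidegreeValue p), π q x = if p = q then x else 0 := by
  -- Eigenspaces are independent automatically, and membership in them is easily checked for images
  -- under operators commuting with `bidegree`.
  let G : ℕ × ℕ → Submodule ℂ (Ext V) :=
    fun p => (bidegree (V := V)).eigenspace (bidegreeValue p)
  have hind : iSupIndep G := (End.eigenspaces_iSupIndep bidegree).comp bidegreeValue_injective
  have htop : ⨆ p, G p = ⊤ := by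
    rw [eq_top_iff, ← iSup_extPiece]
    exact iSup₂_le fun p _ => (extPiece_le_eigenspace p).trans (le_iSup G p)
  let := (DirectSum.isInternal_submodule_of_iSupIndep_of_iSup_eq_top hind htop).chooseDecomposition
  refine ⟨fun q => (G q).subtype ∘ₗ DirectSum.component ℂ _ _ q ∘ₗ
    (DirectSum.decomposeLinearEquiv G).toLinearMap, fun p q x hx => ?_⟩
  split_ifs with h
  · subst h
    exact DirectSum.decompose_of_mem_same G hx
  · exact DirectSum.decompose_of_mem_ne G hx h

lemma exists_decomposition (x : Ext V) : ∃ y : ℕ × ℕ → Ext V,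
    (∀ p, y p ∈ extPiece V p.1 p.2) ∧ ∑ p ∈ bidegrees V, y p = x := by
  have hx : x ∈ ⨆ p ∈ bidegrees V, extPiece V p.1 p.2 := by
    rw [iSup_extPiece]
    exact Submodule.mem_top
  obtain ⟨y, hy⟩ := (Submodule.mem_iSup_finset_iff_exists_sum _ _).mp hx
  exact ⟨fun p => y p, fun p => (y p).2, hy⟩

/-- Components in distinct bidegrees are independent. -/
lemma eq_zero_of_sum_eq_zero {s : Finset (ℕ × ℕ)} {y : ℕ × ℕ → Ext V}
    (hy : ∀ p ∈ s, y p ∈ (bidegree (V := V)).eigenspace (bidegreeValue p))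
    (h : ∑ p ∈ s, y p = 0) {p : ℕ × ℕ} (hp : p ∈ s) : y p = 0 := by
  obtain ⟨π, hπ⟩ := exists_projections (V := V)
  have := congrArg (π p) h
  rw [map_sum, map_zero, Finset.sum_congr rfl fun q hq => hπ q p _ (hy q hq)] at this
  simpa [hp] using this

end FiniteDimensional

/-! ### The sl₂-action and injectivity below the middle degree -/

section Lefschetz

variable [FiniteDimensional ℂ V]

lemma dVec_vecDegree (φ : Dual ℂ V) (x : Ext V) :
    dVec φ (vecDegree x) = dVec φ x + vecDegree (dVec φ x) := by
  have h : ∀ i, dVec φ (vec (finBasis ℂ V i) * dVec ((finBasis ℂ V).coord i) x) =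
      φ (finBasis ℂ V i) • dVec ((finBasis ℂ V).coord i) x +
        vec (finBasis ℂ V i) * dVec ((finBasis ℂ V).coord i) (dVec φ x) := fun i => by
    rw [dVec_vec_mul, dVec_dVec φ, mul_neg, sub_neg_eq_add]
  rw [vecDegree_apply, vecDegree_apply, map_sum, Finset.sum_congr rfl fun i _ => h i,
    Finset.sum_add_distrib]
  congr 1
  conv_rhs => rw [← sum_apply_smul_coord φ]
  simp only [map_sum, map_smul, LinearMap.sum_apply, LinearMap.smul_apply]

lemma dVec_covecDegree (φ : Dual ℂ V) (x : Ext V) :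
    dVec φ (covecDegree x) = covecDegree (dVec φ x) := by
  rw [covecDegree_apply, covecDegree_apply, map_sum]
  refine Finset.sum_congr rfl fun i _ => ?_
  rw [dVec_covec_mul, dVec_dCovec φ, mul_neg, neg_neg]

lemma dCovec_vecDegree (v : V) (x : Ext V) :
    dCovec v (vecDegree x) = vecDegree (dCovec v x) := by
  rw [vecDegree_apply, vecDegree_apply, map_sum]
  refine Finset.sum_congr rfl fun i _ => ?_
  rw [dCovec_vec_mul, dVec_dCovec, mul_neg]

lemma dCovec_covecDegree (v : V) (x : Ext V) :
    dCovec v (covecDegree x) = dCovec v x + covecDegree (dCovec v x) := by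
  have h : ∀ i, dCovec v (covec ((finBasis ℂ V).coord i) * dCovec (finBasis ℂ V i) x) =
      (finBasis ℂ V).coord i v • dCovec (finBasis ℂ V i) x +
        covec ((finBasis ℂ V).coord i) * dCovec (finBasis ℂ V i) (dCovec v x) := fun i => by
    rw [dCovec_covec_mul, dCovec_dCovec v, mul_neg, sub_neg_eq_add]
  rw [covecDegree_apply, covecDegree_apply, map_sum, Finset.sum_congr rfl fun i _ => h i,
    Finset.sum_add_distrib]
  congr 1
  conv_rhs => rw [← sum_coord_smul v]
  simp only [map_sum, map_smul, LinearMap.sum_apply, LinearMap.smul_apply]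

/-- Each summand removes one vector and one covector. The eigenvalue is any complex number, so that
negative degrees can be reached and excluded later. -/
lemma degree_dualLefschetz {c : ℂ} {x : Ext V} (hx : vecDegree x + covecDegree x = c • x) :
    vecDegree (dualLefschetz x) + covecDegree (dualLefschetz x) =
      (c - 2) • dualLefschetz x := by
  have h : ∀ (φ : Dual ℂ V) (v : V), vecDegree (dVec φ (dCovec v x)) +
      covecDegree (dVec φ (dCovec v x)) = (c - 2) • dVec φ (dCovec v x) := fun φ v => by
    have h₁ := congrArg (dVec φ ∘ dCovec v) hx
    simp only [Function.comp, map_add, map_smul, dCovec_vecDegree, dCovec_covecDegree,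
      dVec_vecDegree, dVec_covecDegree] at h₁
    linear_combination (norm := module) (1 : ℂ) • h₁
  rw [dualLefschetz_apply, map_sum, map_sum, ← Finset.sum_add_distrib, Finset.smul_sum]
  exact Finset.sum_congr rfl fun i _ => h _ _

lemma dualLefschetz_vec_mul (v : V) (x : Ext V) :
    dualLefschetz (vec v * x) = vec v * dualLefschetz x - dCovec v x := by
  have h : ∀ i, dVec ((finBasis ℂ V).coord i) (dCovec (finBasis ℂ V i) (vec v * x)) =
      vec v * dVec ((finBasis ℂ V).coord i) (dCovec (finBasis ℂ V i) x) -
        (finBasis ℂ V).coord i v • dCovec (finBasis ℂ V i) x := fun i => by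
    rw [dCovec_vec_mul, map_neg, dVec_vec_mul, neg_sub]
  rw [dualLefschetz_apply, Finset.sum_congr rfl fun i _ => h i, Finset.sum_sub_distrib,
    ← Finset.mul_sum, ← dualLefschetz_apply]
  congr 1
  conv_rhs => rw [← sum_coord_smul v]
  simp only [map_sum, map_smul, LinearMap.sum_apply, LinearMap.smul_apply]

lemma dualLefschetz_covec_mul (φ : Dual ℂ V) (x : Ext V) :
    dualLefschetz (covec φ * x) = dVec φ x + covec φ * dualLefschetz x := by
  have h : ∀ i, dVec ((finBasis ℂ V).coord i) (dCovec (finBasis ℂ V i) (covec φ * x)) =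
      φ (finBasis ℂ V i) • dVec ((finBasis ℂ V).coord i) x +
        covec φ * dVec ((finBasis ℂ V).coord i) (dCovec (finBasis ℂ V i) x) := fun i => by
    rw [dCovec_covec_mul, map_sub, map_smul, dVec_covec_mul, sub_neg_eq_add]
  rw [dualLefschetz_apply, Finset.sum_congr rfl fun i _ => h i, Finset.sum_add_distrib,
    ← Finset.mul_sum, ← dualLefschetz_apply]
  congr 1
  conv_rhs => rw [← sum_apply_smul_coord φ]
  simp only [map_sum, map_smul, LinearMap.sum_apply, LinearMap.smul_apply]

/-- The `sl₂`-relation. -/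
lemma dualLefschetz_lefschetz_mul (x : Ext V) :
    dualLefschetz (lefschetz V * x) = lefschetz V * dualLefschetz x +
      (vecDegree x + covecDegree x - (finrank ℂ V : ℂ) • x) := by
  have h : ∀ i, dualLefschetz (vec (finBasis ℂ V i) * (covec ((finBasis ℂ V).coord i) * x)) =
      vec (finBasis ℂ V i) * (covec ((finBasis ℂ V).coord i) * dualLefschetz x) +
      (vec (finBasis ℂ V i) * dVec ((finBasis ℂ V).coord i) x +
        covec ((finBasis ℂ V).coord i) * dCovec (finBasis ℂ V i) x - x) := fun i => by
    rw [dualLefschetz_vec_mul, dualLefschetz_covec_mul, dCovec_covec_mul]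
    simp only [Basis.coord_apply, Basis.repr_self, Finsupp.single_eq_same, one_smul, mul_add]
    abel
  rw [lefschetz_mul, map_sum, Finset.sum_congr rfl fun i _ => h i, Finset.sum_add_distrib,
    Finset.sum_sub_distrib, Finset.sum_add_distrib, ← lefschetz_mul, ← vecDegree_apply,
    ← covecDegree_apply]
  simp [← Nat.cast_smul_eq_nsmul ℂ]

/-- The total degree has only natural numbers as eigenvalues. -/
lemma eq_zero_of_degree_eq {c : ℂ} (hc : ∀ k : ℕ, c ≠ k) {x : Ext V}
    (hx : vecDegree x + covecDegree x = c • x) : x = 0 := by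
  obtain ⟨y, hy, rfl⟩ := exists_decomposition x
  have h : ∑ p ∈ bidegrees V, (((p.1 + p.2 : ℕ) : ℂ) - c) • y p = 0 := by
    rw [map_sum, map_sum, ← Finset.sum_add_distrib, Finset.smul_sum, ← sub_eq_zero,
      ← Finset.sum_sub_distrib] at hx
    rw [← hx]
    refine Finset.sum_congr rfl fun p _ => ?_
    rw [vecDegree_extPiece (hy p), covecDegree_extPiece (hy p)]
    push_cast
    module
  refine Finset.sum_eq_zero fun p hp => ?_
  have := eq_zero_of_sum_eq_zero
    (fun p _ => extPiece_le_eigenspace p (Submodule.smul_mem _ _ (hy p))) h hp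
  exact (smul_eq_zero.mp this).resolve_left (sub_ne_zero.mpr (hc _).symm)

lemma degree_dualLefschetz_pow {c : ℂ} {x : Ext V} (hx : vecDegree x + covecDegree x = c • x)
    (r : ℕ) : vecDegree ((dualLefschetz ^ r) x) + covecDegree ((dualLefschetz ^ r) x) =
      (c - 2 * r) • (dualLefschetz ^ r) x := by
  induction r with
  | zero => simpa using hx
  | succ r ih =>
    rw [pow_succ', Module.End.mul_apply, degree_dualLefschetz ih]
    congr 1
    push_cast; ring

/-- Multiplication by the Lefschetz element is injective below the middle degree. -/
theorem eq_zero_of_lefschetz_mul_eq_zero {m : ℕ} (hm : m < finrank ℂ V) {x : Ext V}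
    (hx : vecDegree x + covecDegree x = (m : ℂ) • x) (h : lefschetz V * x = 0) : x = 0 := by
  -- The usual sl₂ induction: the commutator acts on the r-th lowering of x, of degree m - 2r, by m
  -- - 2r - n. The factor on the right is nonzero since m < n.
  have hform : ∀ r : ℕ, lefschetz V * (dualLefschetz ^ (r + 1)) x =
      ((r + 1) * ((finrank ℂ V : ℂ) - m + r)) • (dualLefschetz ^ r) x := by
    intro r
    induction r with
    | zero =>
      have := dualLefschetz_lefschetz_mul x
      rw [h, map_zero, hx] at this
      simp only [zero_add, pow_one, pow_zero, Module.End.one_apply, Nat.cast_zero]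
      linear_combination (norm := module) (-1 : ℂ) • this
    | succ r ih =>
      have := dualLefschetz_lefschetz_mul ((dualLefschetz ^ (r + 1)) x)
      rw [ih, degree_dualLefschetz_pow hx, map_smul, ← Module.End.mul_apply, ← pow_succ',
        ← Module.End.mul_apply, ← pow_succ'] at this
      push_cast at this ⊢
      linear_combination (norm := module) (-1 : ℂ) • this
  have hdesc : ∀ r : ℕ, (dualLefschetz ^ r) x = 0 → x = 0 := by
    intro r
    induction r with
    | zero => exact id
    | succ r ih =>
      intro hr
      refine ih ?_
      have := hform r
      rw [hr, mul_zero, eq_comm, smul_eq_zero] at this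
      refine this.resolve_left (mul_ne_zero (by exact_mod_cast r.succ_ne_zero) ?_)
      obtain ⟨d, hd⟩ := Nat.exists_eq_add_of_lt hm
      rw [hd]
      push_cast
      have : ((d + 1 + r : ℕ) : ℂ) ≠ 0 := by exact_mod_cast (by omega)
      convert this using 1
      push_cast; ring
  -- After m + 1 lowerings the degree would be -m - 2, so the result is zero; descent then gives x =
  -- 0.
  refine hdesc (m + 1) (eq_zero_of_degree_eq (c := m - 2 * (m + 1 : ℕ)) (fun k hk => ?_)
    (degree_dualLefschetz_pow hx (m + 1)))
  have : ((m + k + 2 : ℕ) : ℂ) = 0 := by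
    push_cast at hk ⊢
    linear_combination -hk
  have := Nat.cast_eq_zero.mp this
  omega

/-! ### Invariants and the coinvariant ideal -/

lemma lefschetz_mul_ι_mul (m : V × Dual ℂ V) (x : Ext V) :
    lefschetz V * (ExteriorAlgebra.ι ℂ m * x) = ExteriorAlgebra.ι ℂ m * (lefschetz V * x) := by
  rw [lefschetz_mul, lefschetz_mul, Finset.mul_sum]
  refine Finset.sum_congr rfl fun i _ => ?_
  rw [show covec ((finBasis ℂ V).coord i) * (ExteriorAlgebra.ι ℂ m * x) =
    -(ExteriorAlgebra.ι ℂ m * (covec ((finBasis ℂ V).coord i) * x)) from ι_mul_ι_mul _ _ _,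
    mul_neg]
  exact neg_eq_iff_eq_neg.mpr (ι_mul_ι_mul _ _ _)

/-- ℓ is even, hence central; its left multiples thus form a two-sided ideal. -/
lemma lefschetz_comm (x : Ext V) : lefschetz V * x = x * lefschetz V := by
  induction x using ext_induction with
  | one => rw [mul_one, one_mul]
  | smul c x hx => rw [mul_smul_comm, hx, smul_mul_assoc]
  | add x y hx hy => rw [mul_add, add_mul, hx, hy]
  | ι_mul m x hx => rw [lefschetz_mul_ι_mul, hx, mul_assoc]

lemma lefschetz_mul_mem_extPiece {i j : ℕ} {x : Ext V} (hx : x ∈ extPiece V i j) :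
    lefschetz V * x ∈ extPiece V (i + 1) (j + 1) := by
  rw [lefschetz_mul]
  exact sum_mem fun k _ => vec_mul_mem_extPiece _ (covec_mul_mem_extPiece _ hx)

/-- ℓ corresponds to the identity under V ⊗ V* ≅ End(V), which conjugation fixes. -/
lemma act_lefschetz (g : V ≃ₗ[ℂ] V) : act g (lefschetz V) = lefschetz V := by
  have hv : ∀ v, act g (vec v) = vec (g v) := fun v => by simp [act, vec]
  have hc : ∀ φ, act g (covec φ) =
      ∑ j, φ (g.symm (finBasis ℂ V j)) • covec ((finBasis ℂ V).coord j) := fun φ => by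
    have : act g (covec φ) = covec (g.symm.dualMap φ) := by simp [act, covec]
    rw [this, ← sum_apply_smul_coord (g.symm.dualMap φ)]
    simp
  simp only [lefschetz, map_sum, map_mul, hv, hc, Finset.mul_sum, mul_smul_comm]
  rw [Finset.sum_comm]
  refine Finset.sum_congr rfl fun j _ => ?_
  have h := congrArg (fun v => vec (g v) * covec ((finBasis ℂ V).coord j))
    (sum_coord_smul (g.symm (finBasis ℂ V j)))
  simpa only [map_sum, map_smul, LinearEquiv.apply_symm_apply, Finset.sum_mul,
    smul_mul_assoc] using h

lemma algebraMapInv_lefschetz : ExteriorAlgebra.algebraMapInv (lefschetz V) = 0 := by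
  simp [lefschetz, vec, covec, ExteriorAlgebra.algebraMapInv]

/-- The `gl(V)`-invariants satisfy a Casimir identity. -/
lemma lefschetz_mul_dualLefschetz {x : Ext V}
    (hx : ∀ (a : V) (f : Dual ℂ V), rankOneDer a f x = 0) :
    vecDegree (vecDegree x) - ((finrank ℂ V : ℂ) + 1) • vecDegree x =
      lefschetz V * dualLefschetz x := by
  -- Invariance under eᵢ ⊗ φ, contracted with the dual basis form eᵢ* and summed over i.
  have h₁ : ∀ φ : Dual ℂ V, vecDegree (dVec φ x) - (finrank ℂ V : ℂ) • dVec φ x =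
      covec φ * dualLefschetz x := fun φ => by
    have h : ∀ i, dVec ((finBasis ℂ V).coord i) (vec (finBasis ℂ V i) * dVec φ x) =
        dVec ((finBasis ℂ V).coord i) (covec φ * dCovec (finBasis ℂ V i) x) := fun i => by
      have := hx (finBasis ℂ V i) φ
      rw [rankOneDer_apply, sub_eq_zero] at this
      rw [this]
    have hs := Finset.sum_congr (rfl : (Finset.univ : Finset (Fin (finrank ℂ V))) = _)
      fun i _ => h i
    simp only [dVec_vec_mul, dVec_covec_mul, Finset.sum_sub_distrib, Finset.sum_neg_distrib,
      ← Finset.mul_sum, ← dualLefschetz_apply, ← vecDegree_apply] at hs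
    simp only [Basis.coord_apply, Basis.repr_self, Finsupp.single_eq_same, one_smul,
      Finset.sum_const, Finset.card_univ, Fintype.card_fin, ← Nat.cast_smul_eq_nsmul ℂ] at hs
    linear_combination (norm := module) (-1 : ℂ) • hs
  have h₂ : ∀ (v : V) (y : Ext V), vec v * vecDegree y = vecDegree (vec v * y) - vec v * y :=
    fun v y => by
      have := isDer_vecDegree.map_ι_mul (v, 0) y
      simp only [ι_eq, map_zero, add_zero, LinearMap.prodMap_apply, one_smul,
        LinearMap.id_apply] at this
      rw [this, add_sub_cancel_left]
  -- Multiplying `h₁` for φ = eᵢ* by eᵢ and summing turns the contractions back into `vecDegree`;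
  -- the shift in `h₂` produces the 1 in n + 1.
  rw [lefschetz_mul]
  simp only [← h₁, mul_sub, h₂, mul_smul_comm, Finset.sum_sub_distrib, ← map_sum,
    ← Finset.smul_sum, ← vecDegree_apply]
  module

/-- A `gl(V)`-invariant without constant term is a multiple of the Lefschetz element. -/
theorem exists_eq_lefschetz_mul {x : Ext V}
    (hx : ∀ (a : V) (f : Dual ℂ V), rankOneDer a f x = 0)
    (h0 : ExteriorAlgebra.algebraMapInv x = 0) : ∃ y, x = lefschetz V * y := by
  obtain ⟨y, hy, rfl⟩ := exists_decomposition x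
  have hcomm : ∀ (a : V) (f : Dual ℂ V) (z : Ext V),
      bidegree (rankOneDer a f z) = rankOneDer a f (bidegree z) := fun a f z => by
    have h := (isDer_vecDegree.add (isDer_covecDegree.smul Complex.I)).commutator
      (isDer_rankOneDer a f)
    have := LinearMap.congr_fun (h.unique (T' := 0) (by
      constructor
      · simp
      · intro m z
        simp [rankOne])) z
    exact sub_eq_zero.mp this
  -- The action of gl(V) preserves bidegrees, so components of an invariant are invariant.
  have hyinv : ∀ p ∈ bidegrees V, ∀ (a : V) (f : Dual ℂ V), rankOneDer a f (y p) = 0 := by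
    intro p hp a f
    have h := hx a f
    rw [map_sum] at h
    refine eq_zero_of_sum_eq_zero (y := fun p => rankOneDer a f (y p)) (fun p _ => ?_) h hp
    rw [End.mem_eigenspace_iff, hcomm, End.mem_eigenspace_iff.mp (extPiece_le_eigenspace p (hy p)),
      map_smul]
  have hdiag : ∀ p ∈ bidegrees V, p ≠ (0, 0) →
      y p ∈ LinearMap.range (LinearMap.mulLeft ℂ (lefschetz V)) := by
    rintro ⟨i, j⟩ hp hne
    by_cases hij : i = j
    · subst hij
      have hi : i ≠ 0 := by rintro rfl; exact hne rfl
      have hin : i ≤ finrank ℂ V := by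
        have := (Finset.mem_product.mp hp).1
        rw [Finset.mem_range] at this
        exact Nat.lt_succ_iff.mp this
      -- In bidegree (i, i) the Casimir identity has the scalar i(i - n - 1) on the left, nonzero
      -- for 1 ≤ i ≤ n.
      have h := lefschetz_mul_dualLefschetz (hyinv _ hp)
      rw [vecDegree_extPiece (hy (i, i)), map_smul, vecDegree_extPiece (hy (i, i))] at h
      have hne : (i : ℂ) * ((i : ℂ) - (finrank ℂ V + 1)) ≠ 0 := by
        refine mul_ne_zero (by exact_mod_cast hi) (sub_ne_zero.mpr ?_)
        exact_mod_cast (by omega : i ≠ finrank ℂ V + 1)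
      rw [← Submodule.smul_mem_iff _ hne]
      refine ⟨dualLefschetz (y (i, i)), ?_⟩
      rw [LinearMap.mulLeft_apply, ← h]
      module
    -- The identity of gl(V), the sum of the eₖ ⊗ eₖ*, acts by i - j, so off-diagonal components
    -- vanish.
    · have h : vecDegree (y (i, j)) - covecDegree (y (i, j)) = 0 := by
        rw [vecDegree_apply, covecDegree_apply, ← Finset.sum_sub_distrib]
        exact Finset.sum_eq_zero fun k _ => hyinv _ hp _ _
      rw [vecDegree_extPiece (hy (i, j)), covecDegree_extPiece (hy (i, j)), ← sub_smul,
        smul_eq_zero] at h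
      rw [h.resolve_left (sub_ne_zero.mpr (by exact_mod_cast hij))]
      exact zero_mem _
  have hmem : (0, 0) ∈ bidegrees V := by simp [bidegrees]
  have hrest : ∑ p ∈ (bidegrees V).erase (0, 0), y p ∈
      LinearMap.range (LinearMap.mulLeft ℂ (lefschetz V)) :=
    sum_mem fun p hp => hdiag p (Finset.mem_of_mem_erase hp) (Finset.ne_of_mem_erase hp)
  obtain ⟨z, hz⟩ := hrest
  rw [LinearMap.mulLeft_apply] at hz
  rw [← Finset.add_sum_erase _ _ hmem, ← hz] at h0 ⊢
  have hy0 : y (0, 0) ∈ Submodule.span ℂ {(1 : Ext V)} := extPiece_zero (V := V) ▸ hy (0, 0)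
  obtain ⟨c, hc⟩ := Submodule.mem_span_singleton.mp hy0
  rw [map_add, map_mul, algebraMapInv_lefschetz, zero_mul, add_zero, ← hc, map_smul, map_one,
    smul_eq_mul, mul_one] at h0
  exact ⟨z, by rw [← hc, h0, zero_smul, zero_add]⟩

/-- The coinvariant ideal of an irreducible reflection group is generated by the Lefschetz
element. -/
theorem mem_coinvariantIdeal_iff {W : Subgroup (V ≃ₗ[ℂ] V)} (hW : IsComplexReflectionGroup W)
    (hirr : IsIrreducible W) (hne : finrank ℂ V = 1 → W ≠ ⊥) {x : Ext V} :
    x ∈ coinvariantIdeal W ↔ ∃ y, x = lefschetz V * y := by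
  have hinv : ∀ x : Ext V, (∀ g ∈ W, act g x = x) → ∀ (a : V) (f : Dual ℂ V),
      rankOneDer a f x = 0 := by
    intro x hx a f
    by_cases h0 : finrank ℂ V = 0
    · have := finrank_zero_iff.mp h0
      simp [rankOneDer_apply, Subsingleton.elim a 0, Subsingleton.elim f 0]
    · obtain ⟨s, hs, hs'⟩ := exists_reflection hW hirr h0 hne
      exact rankOneDer_eq_zero hW hirr hs hs' hx a f
  constructor
  · let J : TwoSidedIdeal (Ext V) := TwoSidedIdeal.mk' {x | ∃ y, x = lefschetz V * y}
      ⟨0, by simp⟩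
      (by rintro _ _ ⟨y, rfl⟩ ⟨z, rfl⟩; exact ⟨y + z, by rw [mul_add]⟩)
      (by rintro _ ⟨y, rfl⟩; exact ⟨-y, by rw [mul_neg]⟩)
      (by rintro w _ ⟨y, rfl⟩; exact ⟨w * y, by rw [← mul_assoc, ← lefschetz_comm, mul_assoc]⟩)
      (by rintro _ w ⟨y, rfl⟩; exact ⟨y * w, by rw [mul_assoc]⟩)
    have hle : coinvariantIdeal W ≤ J := by
      rw [coinvariantIdeal, TwoSidedIdeal.span_le]
      rintro x ⟨hx, h0⟩
      exact (TwoSidedIdeal.mem_mk' _ _ _ _ _ _ _).mpr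
        (exists_eq_lefschetz_mul (hinv x hx) h0)
    intro hx
    have hxJ := hle hx
    rwa [TwoSidedIdeal.mem_mk'] at hxJ
  · rintro ⟨y, rfl⟩
    exact TwoSidedIdeal.mul_mem_right _ _ _ (TwoSidedIdeal.subset_span
      ⟨fun g _ => act_lefschetz g, algebraMapInv_lefschetz⟩)

/-! ### Dimensions of the quotient -/

/-- The bihomogeneous elements of the ideal generated by the Lefschetz element. -/
lemma exists_mem_extPiece_of_lefschetz_mul {q : ℕ × ℕ} {y : Ext V}
    (h : lefschetz V * y ∈ extPiece V q.1 q.2) :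
    lefschetz V * y = 0 ∨ ∃ i j, q = (i + 1, j + 1) ∧
      ∃ z ∈ extPiece V i j, lefschetz V * y = lefschetz V * z := by
  obtain ⟨π, hπ⟩ := exists_projections (V := V)
  obtain ⟨u, hu, rfl⟩ := exists_decomposition y
  have hq := hπ q q _ (extPiece_le_eigenspace q h)
  rw [if_pos rfl] at hq
  -- At most one component of y is moved into bidegree q by ℓ; projecting onto q isolates it.
  by_cases hex : ∃ p ∈ bidegrees V, (p.1 + 1, p.2 + 1) = q
  · obtain ⟨p, hp, rfl⟩ := hex
    refine Or.inr ⟨p.1, p.2, rfl, u p, hu p, ?_⟩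
    rw [← hq, Finset.mul_sum, map_sum, Finset.sum_eq_single_of_mem p hp]
    · rw [hπ (p.1 + 1, p.2 + 1) _ _
        (extPiece_le_eigenspace (p.1 + 1, p.2 + 1) (lefschetz_mul_mem_extPiece (hu p))), if_pos rfl]
    · intro p' _ hne
      rw [hπ (p'.1 + 1, p'.2 + 1) _ _
        (extPiece_le_eigenspace (p'.1 + 1, p'.2 + 1) (lefschetz_mul_mem_extPiece (hu p'))),
        if_neg]
      intro e
      simp only [Prod.mk.injEq, Nat.add_right_cancel_iff] at e
      exact hne (Prod.ext e.1 e.2)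
  · left
    rw [← hq, Finset.mul_sum, map_sum]
    refine Finset.sum_eq_zero fun p hp => ?_
    rw [hπ (p.1 + 1, p.2 + 1) _ _
        (extPiece_le_eigenspace (p.1 + 1, p.2 + 1) (lefschetz_mul_mem_extPiece (hu p))), if_neg]
    exact fun e => hex ⟨p, hp, e⟩

/-- Rank-nullity for the quotient map restricted to one component. -/
lemma finrank_drPiece_add {W : Subgroup (V ≃ₗ[ℂ] V)} (hW : IsComplexReflectionGroup W)
    (hirr : IsIrreducible W) (hne : finrank ℂ V = 1 → W ≠ ⊥) (i j : ℕ) :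
    finrank ℂ (drPiece W i j) + finrank ℂ
      ↥(extPiece V i j ⊓ LinearMap.range (LinearMap.mulLeft ℂ (lefschetz V))) =
      (finrank ℂ V).choose i * (finrank ℂ V).choose j := by
  have hker : LinearMap.ker ((coinvariantIdeal W).ringCon.mkₐ (α := ℂ)).toLinearMap =
      LinearMap.range (LinearMap.mulLeft ℂ (lefschetz V)) := by
    ext x
    have h₁ : x ∈ LinearMap.ker ((coinvariantIdeal W).ringCon.mkₐ (α := ℂ)).toLinearMap ↔
        x ∈ coinvariantIdeal W := RingCon.eq _
    rw [h₁, mem_coinvariantIdeal_iff hW hirr hne]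
    simp [eq_comm]
  have h := LinearMap.finrank_range_add_finrank_ker
    (((coinvariantIdeal W).ringCon.mkₐ (α := ℂ)).toLinearMap.domRestrict (extPiece V i j))
  rw [LinearMap.range_domRestrict, LinearMap.ker_domRestrict, hker, finrank_extPiece] at h
  rw [← h, ← Submodule.map_comap_subtype, Submodule.finrank_map_subtype_eq]
  rfl

/-- ℓ has bidegree (1, 1), so the ideal is zero along both edges. -/
lemma finrank_drPiece_of_zero {W : Subgroup (V ≃ₗ[ℂ] V)} (hW : IsComplexReflectionGroup W)
    (hirr : IsIrreducible W) (hne : finrank ℂ V = 1 → W ≠ ⊥) {i j : ℕ} (h : i = 0 ∨ j = 0) :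
    finrank ℂ (drPiece W i j) = (finrank ℂ V).choose i * (finrank ℂ V).choose j := by
  rw [← finrank_drPiece_add hW hirr hne]
  have : extPiece V i j ⊓ LinearMap.range (LinearMap.mulLeft ℂ (lefschetz V)) = ⊥ := by
    rw [eq_bot_iff]
    rintro _ ⟨hx, y, rfl⟩
    rcases exists_mem_extPiece_of_lefschetz_mul (q := (i, j)) hx with h' | ⟨k, l, hkl, -⟩
    · exact h'
    · rw [Prod.mk.injEq] at hkl
      omega
  rw [this, finrank_bot, add_zero]

/-- The ideal in this bidegree is ℓ times the component (i, j), on which multiplication by ℓ is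
injective. -/
lemma finrank_drPiece_succ {W : Subgroup (V ≃ₗ[ℂ] V)} (hW : IsComplexReflectionGroup W)
    (hirr : IsIrreducible W) (hne : finrank ℂ V = 1 → W ≠ ⊥) {i j : ℕ}
    (h : i + j < finrank ℂ V) :
    finrank ℂ (drPiece W (i + 1) (j + 1)) +
      (finrank ℂ V).choose i * (finrank ℂ V).choose j =
      (finrank ℂ V).choose (i + 1) * (finrank ℂ V).choose (j + 1) := by
  rw [← finrank_drPiece_add hW hirr hne (i + 1), ← finrank_extPiece]
  congr 1
  have hinf : extPiece V (i + 1) (j + 1) ⊓ LinearMap.range (LinearMap.mulLeft ℂ (lefschetz V)) =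
      LinearMap.range ((LinearMap.mulLeft ℂ (lefschetz V)).domRestrict (extPiece V i j)) := by
    rw [LinearMap.range_domRestrict]
    apply le_antisymm
    · rintro _ ⟨hx, y, rfl⟩
      rcases exists_mem_extPiece_of_lefschetz_mul (q := (i + 1, j + 1)) hx with
        h' | ⟨k, l, hkl, z, hz, e⟩
      · exact ⟨0, zero_mem _, by rw [map_zero]; exact h'.symm⟩
      · simp only [Prod.mk.injEq, Nat.add_right_cancel_iff] at hkl
        obtain ⟨rfl, rfl⟩ := hkl
        exact ⟨z, hz, e.symm⟩
    · rintro _ ⟨z, hz, rfl⟩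
      exact ⟨lefschetz_mul_mem_extPiece hz, z, rfl⟩
  rw [hinf, LinearMap.finrank_range_of_inj]
  rw [injective_iff_map_eq_zero]
  rintro ⟨x, hx⟩ h0
  refine Subtype.ext (eq_zero_of_lefschetz_mul_eq_zero h ?_ h0)
  rw [vecDegree_extPiece hx, covecDegree_extPiece hx]
  push_cast
  module

end Lefschetz

/-! ### Narayana and Catalan numbers -/

/-- The Narayana numbers as `2 × 2` determinants of binomial coefficients. -/
lemma choose_mul_choose_sub (a b : ℕ) :
    ((a + b + 2).choose (a + 1) : ℚ) * ((a + b + 2).choose (b + 1) : ℚ) -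
      ((a + b + 2).choose a : ℚ) * ((a + b + 2).choose b : ℚ) =
      narayana (a + b + 2 + 1) (a + 1 + 1) := by
  have h : ∀ m i j : ℕ, m = i + j →
      (m.choose i : ℚ) = m.factorial / (i.factorial * j.factorial) := by
    rintro _ i j rfl
    exact Nat.cast_add_choose ℚ
  simp only [narayana]
  rw [h (a + b + 2) (a + 1) (b + 1) (by ring), h (a + b + 2) (b + 1) (a + 1) (by ring),
    h (a + b + 2) a (b + 2) (by ring), h (a + b + 2) b (a + 2) (by ring),
    h (a + b + 2 + 1) (a + 1 + 1) (b + 1) (by ring), h (a + b + 2 + 1) (a + 1) (b + 2) (by ring)]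
  have e₁ := Nat.factorial_ne_zero a
  have e₂ := Nat.factorial_ne_zero b
  rw [Nat.factorial_succ (a + b + 2), Nat.factorial_succ (a + 1), Nat.factorial_succ (b + 1),
    Nat.factorial_succ a, Nat.factorial_succ b]
  push_cast
  field_simp
  ring

/-- Replacing C(n+1, k+1) by C(n+1, n-k) makes the sum a Vandermonde convolution with value C(2n+2,
n) = (n+1) Cat(n+1). -/
lemma sum_narayana (n : ℕ) :
    ∑ k ∈ Finset.range (n + 1), narayana (n + 1) (k + 1) = catalan (n + 1) := by
  have hv : ∑ k ∈ Finset.range (n + 1), (n + 1).choose (k + 1) * (n + 1).choose k =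
      (n + 1 + (n + 1)).choose n := by
    rw [Nat.add_choose_eq, Finset.Nat.sum_antidiagonal_eq_sum_range_succ
      (fun i j => (n + 1).choose i * (n + 1).choose j) n]
    refine Finset.sum_congr rfl fun k hk => ?_
    rw [Finset.mem_range] at hk
    rw [mul_comm, ← Nat.choose_symm (show k + 1 ≤ n + 1 by omega)]
    congr 2
    omega
  have hc := succ_mul_catalan_eq_centralBinom (n + 1)
  have hs := Nat.choose_succ_right_eq (n + 1 + (n + 1)) n
  rw [Nat.centralBinom, two_mul] at hc
  rw [← hc, show n + 1 + (n + 1) - n = n + 2 by omega] at hs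
  have key : (n + 1) * catalan (n + 1) = (n + 1 + (n + 1)).choose n :=
    Nat.eq_of_mul_eq_mul_right (show 0 < n + 2 by omega) (by rw [← hs]; ring)
  have h : ∀ k, narayana (n + 1) (k + 1) =
      1 / ((n + 1 : ℕ) : ℚ) * (((n + 1).choose (k + 1) * (n + 1).choose k : ℕ) : ℚ) :=
    fun k => by simp only [narayana]; push_cast; ring
  simp only [h]
  rw [← Finset.mul_sum, ← Nat.cast_sum, hv, ← key]
  push_cast
  field_simp

end FermionicCoinvariants
end

theorem corollary4p5 {V : Type*} [AddCommGroup V] [Module ℂ V] [FiniteDimensional ℂ V]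
    (n : ℕ) (hn : Module.finrank ℂ V = n)
    (W : Subgroup (V ≃ₗ[ℂ] V))
    (hW : FermionicCoinvariants.IsComplexReflectionGroup W)
    (hirr : FermionicCoinvariants.IsIrreducible W)
    (hne : n = 1 → W ≠ ⊥) :
    (∀ k : ℕ, k ≤ n →
      (Module.finrank ℂ (FermionicCoinvariants.drPiece W k (n - k)) : ℚ) =
        FermionicCoinvariants.narayana (n + 1) (k + 1)) ∧
    ∑ k ∈ Finset.range (n + 1),
      Module.finrank ℂ (FermionicCoinvariants.drPiece W k (n - k)) = catalan (n + 1) := by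
  have main : ∀ k : ℕ, k ≤ n →
      (Module.finrank ℂ (FermionicCoinvariants.drPiece W k (n - k)) : ℚ) =
        FermionicCoinvariants.narayana (n + 1) (k + 1) := by
    subst hn
    intro k hk
    -- At k = 0 and k = n both sides are 1. Otherwise k = a + 1 and n - k = b + 1, so a + b = n - 2
    -- is below the middle degree.
    by_cases h0 : k = 0 ∨ Module.finrank ℂ V - k = 0
    · rw [FermionicCoinvariants.finrank_drPiece_of_zero hW hirr hne h0, Nat.choose_symm hk]
      have hn1 : ((Module.finrank ℂ V : ℚ) + 1) ≠ 0 := by positivity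
      rcases h0 with rfl | h
      · simp [FermionicCoinvariants.narayana, hn1]
      · obtain rfl : k = Module.finrank ℂ V := by omega
        simp [FermionicCoinvariants.narayana, hn1]
    · obtain ⟨a, rfl⟩ := Nat.exists_eq_succ_of_ne_zero fun h => h0 (Or.inl h)
      obtain ⟨b, hb⟩ := Nat.exists_eq_succ_of_ne_zero fun h => h0 (Or.inr h)
      have hab : Module.finrank ℂ V = a + b + 2 := by omega
      have h := FermionicCoinvariants.finrank_drPiece_succ hW hirr hne
        (i := a) (j := b) (by omega)
      rw [hb]
      rw [hab] at h ⊢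
      rw [← FermionicCoinvariants.choose_mul_choose_sub, eq_sub_iff_add_eq]
      exact_mod_cast h
  refine ⟨main, ?_⟩
  have h := FermionicCoinvariants.sum_narayana n
  rw [← Finset.sum_congr rfl fun k hk => main k (Finset.mem_range_succ_iff.mp hk)] at h
  exact_mod_cast h
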